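/- Let $l,\tau,T>0$, $a_1,a_2\in\mathbb R\setminus\{0\}$, $c_1,c_2\in\mathbb R$, and consider $$u_t(x,t)=a_1^2u_{xx}(x,t)+a_2^2u_{xx}(x,t-\tau)+c_1u(x,t)+c_2u(x,t-\tau)+f(x,t),\quad 0\le x\le l,\ 0\le t\le T, \tag{1}$$ $$u(x,t)=\varphi(x,t)\ (0\le x\le l,\ -\tau\le t\le 0),\qquad u(0,t)=\mu_1(t),\ u(l,t)=\mu_2(t)\ (-\tau\le t\le T). \tag{2}$$ A classical solution is a continuous function $u$ on $[0,l]\times[-\tau,T]$ satisfying (1), (2), with $u_{xx}$ continuous on $[0,l]\times[-\tau,T]$ and $u_t$ continuous on $[0,l]\times[0,T]$ (derivatives one-sided at end points). For $b\in\mathbb R$ let $\exp_\tau(b,t)=0$ for $t<-\tau$ and $\exp_\tau(b,t)=\sum_{j=0}^{k}b^j\frac{(t-(j-1)\tau)^j}{j!}$ for $(k-1)\tau\le t<k\tau$, $k=0,1,2,\dots$. Write $h_n=\frac2l\int_0^l h(\xi)\sin(\frac{\pi n}{l}\xi)\,d\xi$ for the sine coefficients of a function $h$ on $[0,l]$; in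 particular $\varphi_n(t)$ denotes those of $\varphi(\cdot,t)$ and $\Psi_n$ those of $\Psi$. For $n\ge1$ put $$L_n=c_1-\left(\tfrac{\pi n}{l}a_1\right)^2,\qquad D_n=\left(c_2-\left(\tfrac{\pi n}{l}a_2\right)^2\right)e^{-L_n\tau},$$ $$m_n(t)=\tfrac2l\int_0^l\left(\mu_1(t)+\tfrac{\xi}{l}(\mu_2(t)-\mu_1(t))\right)\sin(\tfrac{\pi n}{l}\xi)\,d\xi,$$ $$M_n(t)=-\tfrac2l\int_0^l\left(\mu_1'(t)+\tfrac{\xi}{l}(\mu_2'(t)-\mu_1'(t))\right)\sin(\tfrac{\pi n}{l}\xi)\,d\xi+c_1m_n(t)+c_2m_n(t-\tau),$$ and, for a function $h$ on $[-\tau,0]$, $$H_n[h](t)=e^{L_nt}\exp_\tau(D_n,t-\tau)\,h(0)+D_n\int_{-\tau}^0e^{L_n(t-s)}\exp_\tau(D_n,t-2\tau-s)\,h(s)\,ds.$$ Further let $$s_{1n}(t)=H_n[\varphi_n](t),\qquad s_{2n}(t)=-H_n[m_n](t)+\int_0^te^{L_n(t-s)}\exp_\tau(D_n,t-\tau-s)M_n(s)\,ds,$$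 $$R_n(T)=\Psi_n-s_{1n}(T)-s_{2n}(T)-m_n(T),\qquad U_n(t)=e^{-L_n(T-t)}\frac{R_n(T)\,D_n}{\exp_\tau(D_n,T)-1},$$ where it is assumed that $\exp_\tau(D_n,T)\ne1$ for all $n\ge1$. Let $\mu_1,\mu_2$ be continuous on $[-\tau,T]$ and continuously differentiable on $[0,T]$, let $\Psi$ be continuous on $[0,l]$, and let the data be compatible: $\varphi(0,t)=\mu_1(t)$, $\varphi(l,t)=\mu_2(t)$ for $-\tau\le t\le0$, and $\Psi(0)=\mu_1(T)$, $\Psi(l)=\mu_2(T)$. Let $\Phi(x,t)=\varphi(x,t)-\mu_1(t)-\frac xl(\mu_2(t)-\mu_1(t))$ and its derivatives $\partial_t\Phi,\partial_{tt}\Phi$ be continuous on $[0,l]\times[-\tau,0]$, let $\Phi_n=\varphi_n-m_n$ be its sine coefficients, and let $F_n=U_n+M_n$. Put $m=\lceil T/\tau\rceil$ and suppose that for some $\delta>0$ $$\lim_{n\to\infty}n^{2m+1+\delta}\max_{s\in[-\tau,0]}\left(|\Phi_n''(s)|+n^2|\Phi_n'(s)|+n^4|\Phi_n(s)|\right)=0,$$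 $$\lim_{n\to\infty}\max_{1\le k\le m}n^{2(m-k)+1+\delta}\max_{(k-1)\tau\le s\le\min(k\tau,T)}\left(|F_n'(s)|+n^2|F_n(s)|\right)=0,$$ the $F_n$ being differentiable on each interval $[(k-1)\tau,\min(k\tau,T)]$, $1\le k\le m$. Then the series $$U(x,t)=\sum_{n=1}^\infty U_n(t)\sin(\tfrac{\pi n}{l}x)$$ converges absolutely on $[0,l]\times[0,T]$ to a continuous function, problem (1), (2) with $f=U$ has a unique classical solution $u$, and $u(x,T)=\Psi(x)$ for all $0\le x\le l$. -/

import Mathlib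

open Set Filter Topology

noncomputable section

namespace DelayHeat

/-- The delayed exponential function `exp_τ(b, ·)`: it is `0` for `t < -τ`, and for
`(k - 1) τ ≤ t < k τ`, `k = 0, 1, 2, …`, it equals
`∑_{j = 0}^{k} b ^ j (t - (j - 1) τ) ^ j / j!`. For `t ≥ -τ` the index is `k = ⌊t / τ + 1⌋`. -/
def delayedExp (τ b t : ℝ) : ℝ :=
  if t < -τ then 0
  else ∑ j ∈ Finset.range (⌊t / τ + 1⌋₊ + 1),
    b ^ j * (t - ((j : ℝ) - 1) * τ) ^ j / (Nat.factorial j : ℝ)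

/-- The Fourier sine coefficient `(2 / l) ∫₀ˡ h(ξ) sin(π n ξ / l) dξ`. -/
def sineCoeff (l : ℝ) (n : ℕ) (h : ℝ → ℝ) : ℝ :=
  2 / l * ∫ ξ in (0 : ℝ)..l, h ξ * Real.sin (Real.pi * n / l * ξ)

/-- The constants of the delayed heat equation: length `l` of the rod, delay `τ`, final time `T`
and the coefficients `a₁`, `a₂`, `c₁`, `c₂`. -/
structure Params where
  l : ℝ
  τ : ℝ
  T : ℝ
  a₁ : ℝ
  a₂ : ℝ
  c₁ : ℝ
  c₂ : ℝ

variable (P : Params)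

/-- `L_n = c₁ - (π n a₁ / l)²`. -/
def Params.L (n : ℕ) : ℝ := P.c₁ - (Real.pi * n / P.l * P.a₁) ^ 2

/-- `D_n = (c₂ - (π n a₂ / l)²) e^{-L_n τ}`. -/
def Params.D (n : ℕ) : ℝ :=
  (P.c₂ - (Real.pi * n / P.l * P.a₂) ^ 2) * Real.exp (-(P.L n) * P.τ)

/-- The affine extension `μ₁(t) + (x / l) (μ₂(t) - μ₁(t))` of the boundary data. -/
def lift (μ₁ μ₂ : ℝ → ℝ) (x t : ℝ) : ℝ := μ₁ t + x / P.l * (μ₂ t - μ₁ t)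

/-- `m_n(μ₁, μ₂)(t)`: the sine coefficients of the affine extension of the boundary data. -/
def mCoeff (μ₁ μ₂ : ℝ → ℝ) (n : ℕ) (t : ℝ) : ℝ :=
  sineCoeff P.l n (fun ξ => lift P μ₁ μ₂ ξ t)

/-- `M_n(μ₁, μ₂)(t)` for `0 ≤ t ≤ T`: the sine coefficients of the source term that the affine
extension of the boundary data contributes (time derivatives are one-sided at `0` and `T`). -/
def MCoeff (μ₁ μ₂ : ℝ → ℝ) (n : ℕ) (t : ℝ) : ℝ :=
  sineCoeff P.l n
      (fun ξ => -lift P (derivWithin μ₁ (Icc 0 P.T)) (derivWithin μ₂ (Icc 0 P.T)) ξ t)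
    + P.c₁ * mCoeff P μ₁ μ₂ n t + P.c₂ * mCoeff P μ₁ μ₂ n (t - P.τ)

/-- The contribution at time `t` of an initial history with `n`-th sine coefficient `h`:
`e^{L_n t} exp_τ(D_n, t - τ) h(0) + D_n ∫_{-τ}^0 e^{L_n (t - s)} exp_τ(D_n, t - 2τ - s) h(s) ds`. -/
def historyTerm (n : ℕ) (h : ℝ → ℝ) (t : ℝ) : ℝ :=
  Real.exp (P.L n * t) * delayedExp P.τ (P.D n) (t - P.τ) * h 0
    + P.D n * ∫ s in (-P.τ)..0,
        Real.exp (P.L n * (t - s)) * delayedExp P.τ (P.D n) (t - 2 * P.τ - s) * h s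

/-- `s_{1n}(t)`: the contribution of the initial state `φ`. -/
def s₁ (φ : ℝ → ℝ → ℝ) (n : ℕ) (t : ℝ) : ℝ :=
  historyTerm P n (fun s => sineCoeff P.l n (fun ξ => φ ξ s)) t

/-- `s_{2n}(t)`: the contribution of the boundary data (through the history and the source). -/
def s₂ (μ₁ μ₂ : ℝ → ℝ) (n : ℕ) (t : ℝ) : ℝ :=
  -historyTerm P n (mCoeff P μ₁ μ₂ n) t
    + ∫ s in (0 : ℝ)..t,
        Real.exp (P.L n * (t - s)) * delayedExp P.τ (P.D n) (t - P.τ - s) * MCoeff P μ₁ μ₂ n s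

/-- `R_n(T) = Ψ_n - s_{1n}(T) - s_{2n}(T) - m_n(μ₁, μ₂)(T)`. -/
def R (φ : ℝ → ℝ → ℝ) (μ₁ μ₂ Ψ : ℝ → ℝ) (n : ℕ) : ℝ :=
  sineCoeff P.l n Ψ - s₁ P φ n P.T - s₂ P μ₁ μ₂ n P.T - mCoeff P μ₁ μ₂ n P.T

/-- `U_n(t) = e^{-L_n (T - t)} R_n(T) D_n / (exp_τ(D_n, T) - 1)`. -/
def UCoeff (φ : ℝ → ℝ → ℝ) (μ₁ μ₂ Ψ : ℝ → ℝ) (n : ℕ) (t : ℝ) : ℝ :=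
  Real.exp (-(P.L n) * (P.T - t)) *
    (R P φ μ₁ μ₂ Ψ n * P.D n / (delayedExp P.τ (P.D n) P.T - 1))

/-- The control `U(x, t) = ∑_{n ≥ 1} U_n(t) sin(π n x / l)`. -/
def control (φ : ℝ → ℝ → ℝ) (μ₁ μ₂ Ψ : ℝ → ℝ) (x t : ℝ) : ℝ :=
  ∑' n : ℕ, UCoeff P φ μ₁ μ₂ Ψ (n + 1) t * Real.sin (Real.pi * ((n + 1 : ℕ) : ℝ) / P.l * x)

/-- The initial state reduced to homogeneous boundary values, `Φ = φ - lift`. -/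
def Phi (φ : ℝ → ℝ → ℝ) (μ₁ μ₂ : ℝ → ℝ) (x t : ℝ) : ℝ := φ x t - lift P μ₁ μ₂ x t

/-- `Φ_n(t)`. -/
def PhiCoeff (φ : ℝ → ℝ → ℝ) (μ₁ μ₂ : ℝ → ℝ) (n : ℕ) (t : ℝ) : ℝ :=
  sineCoeff P.l n (fun ξ => Phi P φ μ₁ μ₂ ξ t)

/-- `F_n(t)`: the sine coefficients of the reduced source term when the control is the source. -/
def FCoeff (φ : ℝ → ℝ → ℝ) (μ₁ μ₂ Ψ : ℝ → ℝ) (n : ℕ) (t : ℝ) : ℝ :=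
  UCoeff P φ μ₁ μ₂ Ψ n t + MCoeff P μ₁ μ₂ n t

/-- `Φ`, `∂ₜΦ`, `∂ₜₜΦ` exist and are continuous on `[0, l] × [-τ, 0]`. -/
def TimeC2 (Φ : ℝ → ℝ → ℝ) : Prop :=
  ∃ Φ' Φ'' : ℝ → ℝ → ℝ,
    (∀ x ∈ Icc 0 P.l, ∀ t ∈ Icc (-P.τ) 0,
      HasDerivWithinAt (fun s => Φ x s) (Φ' x t) (Icc (-P.τ) 0) t ∧
      HasDerivWithinAt (fun s => Φ' x s) (Φ'' x t) (Icc (-P.τ) 0) t) ∧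
    ContinuousOn (Function.uncurry Φ) (Icc 0 P.l ×ˢ Icc (-P.τ) 0) ∧
    ContinuousOn (Function.uncurry Φ') (Icc 0 P.l ×ˢ Icc (-P.τ) 0) ∧
    ContinuousOn (Function.uncurry Φ'') (Icc 0 P.l ×ˢ Icc (-P.τ) 0)

/-- The number `m = ⌈T / τ⌉` of delay intervals that cover `[0, T]`. -/
def Params.m : ℕ := ⌈P.T / P.τ⌉₊

/-- `n^{2m+1+δ} max_{s ∈ [-τ, 0]} (|Φ_n''(s)| + n² |Φ_n'(s)| + n⁴ |Φ_n(s)|) → 0`; that the maxima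
tend to zero is expressed as uniform convergence to zero. -/
def HistoryDecay (δ : ℝ) (Φn : ℕ → ℝ → ℝ) : Prop :=
  TendstoUniformlyOn
    (fun (n : ℕ) (s : ℝ) => (n : ℝ) ^ (2 * (P.m : ℝ) + 1 + δ) *
      (|iteratedDerivWithin 2 (Φn n) (Icc (-P.τ) 0) s|
        + (n : ℝ) ^ 2 * |derivWithin (Φn n) (Icc (-P.τ) 0) s|
        + (n : ℝ) ^ 4 * |Φn n s|))
    (fun _ => 0) atTop (Icc (-P.τ) 0)

/-- The `k`-th delay interval `[(k - 1) τ, k τ]`, cut off at the final time `T`. -/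
def Params.piece (k : ℕ) : Set ℝ := Icc (((k : ℝ) - 1) * P.τ) (min ((k : ℝ) * P.τ) P.T)

/-- `max_{1 ≤ k ≤ m} n^{2(m-k)+1+δ} max_{(k-1)τ ≤ s ≤ kτ} (|F_n'(s)| + n² |F_n(s)|) → 0`, the `F_n`
(`n ≥ 1`) being differentiable on each of these intervals. -/
def SourceDecay (δ : ℝ) (Fn : ℕ → ℝ → ℝ) : Prop :=
  ∀ k ∈ Finset.Icc 1 P.m,
    (∀ n : ℕ, 1 ≤ n → DifferentiableOn ℝ (Fn n) (P.piece k)) ∧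
    TendstoUniformlyOn
      (fun (n : ℕ) (s : ℝ) => (n : ℝ) ^ (2 * ((P.m : ℝ) - (k : ℝ)) + 1 + δ) *
        (|derivWithin (Fn n) (P.piece k) s| + (n : ℝ) ^ 2 * |Fn n s|))
      (fun _ => 0) atTop (P.piece k)

/-- `u` is a classical solution on `[0, l] × [-τ, T]` of
`uₜ(x,t) = a₁² uₓₓ(x,t) + a₂² uₓₓ(x,t-τ) + c₁ u(x,t) + c₂ u(x,t-τ) + f(x,t)` (`0 ≤ x ≤ l`,
`0 ≤ t ≤ T`) with `u = φ` for `-τ ≤ t ≤ 0`, `u(0,t) = μ₁(t)`, `u(l,t) = μ₂(t)` for `-τ ≤ t ≤ T`.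
Derivatives are one-sided at the end points of `[0, l]` and `[0, T]`. -/
def IsClassicalSolution (f φ : ℝ → ℝ → ℝ) (μ₁ μ₂ : ℝ → ℝ) (u : ℝ → ℝ → ℝ) : Prop :=
  ∃ ut ux uxx : ℝ → ℝ → ℝ,
    ContinuousOn (Function.uncurry u) (Icc 0 P.l ×ˢ Icc (-P.τ) P.T) ∧
    ContinuousOn (Function.uncurry ut) (Icc 0 P.l ×ˢ Icc 0 P.T) ∧
    ContinuousOn (Function.uncurry uxx) (Icc 0 P.l ×ˢ Icc (-P.τ) P.T) ∧
    (∀ x ∈ Icc 0 P.l, ∀ t ∈ Icc 0 P.T,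
      HasDerivWithinAt (fun s => u x s) (ut x t) (Icc 0 P.T) t) ∧
    (∀ x ∈ Icc 0 P.l, ∀ t ∈ Icc (-P.τ) P.T,
      HasDerivWithinAt (fun y => u y t) (ux x t) (Icc 0 P.l) x ∧
      HasDerivWithinAt (fun y => ux y t) (uxx x t) (Icc 0 P.l) x) ∧
    (∀ x ∈ Icc 0 P.l, ∀ t ∈ Icc 0 P.T,
      ut x t = P.a₁ ^ 2 * uxx x t + P.a₂ ^ 2 * uxx x (t - P.τ)
        + P.c₁ * u x t + P.c₂ * u x (t - P.τ) + f x t) ∧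
    (∀ x ∈ Icc 0 P.l, ∀ t ∈ Icc (-P.τ) 0, u x t = φ x t) ∧
    (∀ t ∈ Icc (-P.τ) P.T, u 0 t = μ₁ t ∧ u P.l t = μ₂ t)

end DelayHeat

end

namespace DelayHeat

/-! ### The delayed exponential -/

/-! Subtract from `u` the affine interpolation in `x` of the boundary values and expand the rest in
sines. The modes satisfy z' = L_n z + B_n z(t - τ) + F_n with history Φ_n, where D_n = B_n e^{-L_n
τ}.

The source hypothesis is rigid. Affine functions have sine coefficients of order 1/n, namely M_n =
(2/πn)(p - (-1)^n q), where p and q are the defects -μ' + c₁ μ + c₂ μ(· - τ) of the boundary data.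
But F_n = U_n + M_n is O(n⁻²), and U_n(t) = e^{L_n t} U_n(0) is O(n⁻²) at each t > 0, so p = q = 0
on [0, T] (`boundaryDefect_eq_zero`). Hence F_n = U_n = O(n⁻²) uniformly, which gives convergence
and continuity of the control.

The modes are built by the method of steps. The delayed coefficient B_n costs a factor n², and the
Duhamel integral against e^{-γ n² (t - s)} returns it, so the bound Φ_n = O(n⁻⁴) survives finitely
many delay steps (`exists_abs_delayIter_le`). One time derivative or two space derivatives then
leave O(n⁻²), and the series may be differentiated termwise.

The target is reached because `delay_representation` expresses z_n(T) by history and source. U_n is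
a multiple of e^{L_n t}, so it cancels the exponential of the kernel, and D_n times the integral of
the delayed exponential is exp_τ(D_n, T) - 1 (`mul_integral_delayedExp`): the control contributes
exactly R_n(T). Thus z_n(T) are the coefficients of Ψ minus the affine part, and
`hasSum_sine_series` recovers Ψ.

Uniqueness is again by steps: once two solutions agree up to kτ, the delayed terms cancel on the
next interval and the maximum principle for the ordinary heat equation applies. -/

theorem delayedExp_of_lt {τ b t : ℝ} (ht : t < -τ) : delayedExp τ b t = 0 := if_pos ht

theorem delayedExp_of_mem {τ b t : ℝ} (hτ : 0 < τ) {k : ℕ} (h₁ : ((k : ℝ) - 1) * τ ≤ t)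
    (h₂ : t < k * τ) :
    delayedExp τ b t = ∑ j ∈ Finset.range (k + 1),
      b ^ j * (t - ((j : ℝ) - 1) * τ) ^ j / (Nat.factorial j : ℝ) := by
  have hk : (0 : ℝ) ≤ k := Nat.cast_nonneg k
  have hf : ⌊t / τ + 1⌋₊ = k := by
    have h₁' : (k : ℝ) - 1 ≤ t / τ := (le_div_iff₀ hτ).2 h₁
    have h₂' : t / τ < k := (div_lt_iff₀ hτ).2 h₂
    rw [Nat.floor_eq_iff (by linarith)]
    constructor <;> linarith
  rw [delayedExp, if_neg (by nlinarith), hf]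

theorem exists_delay_index {τ t : ℝ} (hτ : 0 < τ) (ht : -τ ≤ t) :
    ∃ k : ℕ, ((k : ℝ) - 1) * τ ≤ t ∧ t < k * τ := by
  have h0 : 0 ≤ t / τ + 1 := by
    have : t / τ + 1 = (t + τ) / τ := by field_simp
    rw [this]; apply div_nonneg <;> linarith
  have h₁ := Nat.floor_le h0
  have h₂ := Nat.lt_floor_add_one (t / τ + 1)
  refine ⟨⌊t / τ + 1⌋₊, ?_, ?_⟩
  · have : ((⌊t / τ + 1⌋₊ : ℝ) - 1) ≤ t / τ := by linarith
    rwa [le_div_iff₀ hτ] at this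
  · have : t / τ < (⌊t / τ + 1⌋₊ : ℝ) := by linarith
    rwa [div_lt_iff₀ hτ] at this

/-- On `[-τ, N τ)` the delayed exponential is a sum of truncated powers. -/
theorem delayedExp_eq_sum_max {τ b t : ℝ} (hτ : 0 < τ) {N : ℕ} (h₁ : -τ ≤ t) (h₂ : t < N * τ) :
    delayedExp τ b t = ∑ j ∈ Finset.range (N + 1),
      b ^ j * (max (t - ((j : ℝ) - 1) * τ) 0) ^ j / (Nat.factorial j : ℝ) := by
  obtain ⟨k, hk₁, hk₂⟩ := exists_delay_index hτ h₁
  have hkN : k ≤ N := by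
    by_contra! h
    have : (N : ℝ) + 1 ≤ k := by exact_mod_cast h
    nlinarith
  rw [delayedExp_of_mem hτ hk₁ hk₂, ← Finset.sum_subset
    (Finset.range_subset_range.2 (Nat.succ_le_succ hkN))]
  · refine Finset.sum_congr rfl fun j hj => ?_
    have : (j : ℝ) ≤ k := by exact_mod_cast Nat.lt_succ_iff.1 (Finset.mem_range.1 hj)
    rw [max_eq_left]
    nlinarith
  · intro j _ hj
    have hj' : k + 1 ≤ j := by simpa using hj
    have : (k : ℝ) + 1 ≤ j := by exact_mod_cast hj'
    rw [max_eq_right (by nlinarith), zero_pow (by omega)]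
    simp

/-- The delayed exponential jumps from 0 to 1 at `-τ`, so the argument is clamped there. Locally a
single finite sum of truncated powers describes it. -/
theorem continuous_delayedExp_max {τ b : ℝ} (hτ : 0 < τ) :
    Continuous fun t => delayedExp τ b (max t (-τ)) := by
  rw [continuous_iff_continuousAt]
  intro t
  obtain ⟨N, hN⟩ := exists_nat_gt ((max t (-τ) + 1) / τ)
  rw [div_lt_iff₀ hτ] at hN
  have hc : Continuous fun t : ℝ => ∑ j ∈ Finset.range (N + 1),
      b ^ j * (max (max t (-τ) - ((j : ℝ) - 1) * τ) 0) ^ j / (Nat.factorial j : ℝ) := by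
    fun_prop
  refine hc.continuousAt.congr ?_
  have h₁ : ∀ᶠ s in 𝓝 t, max s (-τ) < N * τ :=
    (by fun_prop : Continuous fun s : ℝ => max s (-τ)).continuousAt.eventually_lt_const
      (by linarith)
  filter_upwards [h₁] with s hs
  rw [delayedExp_eq_sum_max hτ (le_max_right _ _) hs]

theorem continuousOn_delayedExp {τ b : ℝ} (hτ : 0 < τ) :
    ContinuousOn (delayedExp τ b) (Ici (-τ)) :=
  (continuous_delayedExp_max (b := b) hτ).continuousOn.congr fun t ht => by
    simp only [max_eq_left (show -τ ≤ t from ht)]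

theorem delayedExp_of_neg {τ b t : ℝ} (hτ : 0 < τ) (h₁ : -τ ≤ t) (h₂ : t < 0) :
    delayedExp τ b t = 1 := by
  rw [delayedExp_of_mem (k := 0) hτ (by simpa using h₁) (by simpa using h₂)]
  simp

theorem delayedExp_zero {τ b : ℝ} (hτ : 0 < τ) : delayedExp τ b 0 = 1 := by
  rw [delayedExp_of_mem (k := 1) hτ (by simp) (by simpa using hτ)]
  simp [Finset.sum_range_succ]

/-- The delayed exponential solves `E'(t) = b E(t - τ)`, with right derivatives. -/
theorem hasDerivWithinAt_delayedExp {τ b t : ℝ} (hτ : 0 < τ) (ht : -τ ≤ t) :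
    HasDerivWithinAt (delayedExp τ b) (b * delayedExp τ b (t - τ)) (Ioi t) t := by
  obtain ⟨k, h₁, h₂⟩ := exists_delay_index hτ ht
  have hpoly : HasDerivAt (fun t : ℝ => ∑ j ∈ Finset.range (k + 1),
      b ^ j * (t - ((j : ℝ) - 1) * τ) ^ j / (Nat.factorial j : ℝ))
      (∑ j ∈ Finset.range (k + 1), b ^ j * (j * (t - ((j : ℝ) - 1) * τ) ^ (j - 1))
        / (Nat.factorial j : ℝ)) t := by
    refine HasDerivAt.fun_sum fun j _ => ?_
    have := (((hasDerivAt_id t).sub_const (((j : ℝ) - 1) * τ)).pow j).const_mul (b ^ j)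
    simpa using this.div_const (Nat.factorial j : ℝ)
  have hval : (∑ j ∈ Finset.range (k + 1), b ^ j * (j * (t - ((j : ℝ) - 1) * τ) ^ (j - 1))
        / (Nat.factorial j : ℝ)) = b * delayedExp τ b (t - τ) := by
    rw [Finset.sum_range_succ']
    rcases k with _ | k
    -- On `[-τ, 0)` the function is constantly 1, and the delayed argument lies below `-τ`, where
    -- the value is 0 by convention.
    · rw [delayedExp_of_lt (by simp at h₂; linarith)]
      simp
    · rw [delayedExp_of_mem (k := k) hτ (by push_cast at h₁; linarith)
        (by push_cast at h₂; linarith), Finset.mul_sum]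
      simp only [Nat.cast_zero, zero_mul, mul_zero, zero_div, add_zero, Nat.add_sub_cancel]
      refine Finset.sum_congr rfl fun j _ => ?_
      rw [Nat.factorial_succ]
      push_cast
      have : (j : ℝ) + 1 ≠ 0 := by positivity
      have : (Nat.factorial j : ℝ) ≠ 0 := by positivity
      field_simp
      ring_nf
  rw [← hval]
  refine hpoly.hasDerivWithinAt.congr_of_eventuallyEq ?_ (delayedExp_of_mem hτ h₁ h₂)
  filter_upwards [Ioo_mem_nhdsGT h₂] with s hs
  exact delayedExp_of_mem hτ (h₁.trans hs.1.le) hs.2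

/-- The integrand is a continuous function cut off to a half-line, so the jump at `-τ` does no harm.
-/
theorem intervalIntegrable_mul_delayedExp {τ b : ℝ} (hτ : 0 < τ) {g : ℝ → ℝ}
    (hg : Continuous g) (c x y : ℝ) :
    IntervalIntegrable (fun r => g r * delayedExp τ b (r - c)) MeasureTheory.volume x y := by
  have hc : Continuous fun r => g r * delayedExp τ b (max (r - c) (-τ)) :=
    hg.mul ((continuous_delayedExp_max hτ).comp (by fun_prop))
  have : (fun r => g r * delayedExp τ b (r - c)) =
      (Ici (c - τ)).indicator fun r => g r * delayedExp τ b (max (r - c) (-τ)) := by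
    ext r
    by_cases hr : c - τ ≤ r
    · rw [indicator_of_mem (show r ∈ Ici (c - τ) from hr), max_eq_left (by linarith)]
    · rw [indicator_of_notMem (by simpa using hr), delayedExp_of_lt (by linarith [not_le.1 hr]),
        mul_zero]
  rw [this]
  have h := hc.intervalIntegrable (μ := MeasureTheory.volume) x y
  exact ⟨h.1.indicator measurableSet_Ici, h.2.indicator measurableSet_Ici⟩

theorem continuousOn_delayedExp_sub {τ b : ℝ} (hτ : 0 < τ) (T : ℝ) :
    ContinuousOn (fun r => delayedExp τ b (r - τ)) (Icc 0 T) :=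
  (continuousOn_delayedExp hτ).comp (by fun_prop) fun r hr => by
    simp only [mem_Ici]; linarith [hr.1]

theorem hasDerivWithinAt_delayedExp_sub {τ b r : ℝ} (hτ : 0 < τ) (hr : 0 ≤ r) :
    HasDerivWithinAt (fun r => delayedExp τ b (r - τ)) (b * delayedExp τ b (r - 2 * τ))
      (Ioi r) r := by
  have h := hasDerivWithinAt_delayedExp (b := b) (t := r - τ) hτ (by linarith)
  have h2 : HasDerivWithinAt (fun r : ℝ => r - τ) 1 (Ioi r) r :=
    ((hasDerivAt_id r).sub_const τ).hasDerivWithinAt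
  have := HasDerivWithinAt.comp r h h2 fun s hs => by
    simpa using hs
  simpa [Function.comp_def, show r - τ - τ = r - 2 * τ by ring] using this

/-- Integrating the delayed exponential. -/
theorem mul_integral_delayedExp {τ b T : ℝ} (hτ : 0 < τ) (hT : 0 ≤ T) :
    b * ∫ s in (0 : ℝ)..T, delayedExp τ b (T - τ - s) = delayedExp τ b T - 1 := by
  have h1 : (∫ s in (0 : ℝ)..T, delayedExp τ b (T - τ - s)) =
      ∫ r in (0 : ℝ)..T, delayedExp τ b (r - τ) := by
    have := intervalIntegral.integral_comp_sub_left (a := 0) (b := T)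
      (fun r => delayedExp τ b (r - τ)) T
    simp only [sub_self, sub_zero] at this
    rw [← this]
    congr 1; ext s; congr 1; ring
  rw [h1, ← intervalIntegral.integral_const_mul, ← delayedExp_zero (b := b) hτ]
  refine intervalIntegral.integral_eq_sub_of_hasDeriv_right_of_le hT ?_ ?_ ?_
  · exact (continuousOn_delayedExp hτ).mono fun r hr => by
      simp only [mem_Ici]; linarith [hr.1]
  · intro r hr
    exact hasDerivWithinAt_delayedExp hτ (by linarith [hr.1])
  · exact intervalIntegrable_mul_delayedExp hτ continuous_const τ 0 T

/-- The representation of the solution of a scalar linear equation with delay. -/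
theorem delay_representation {τ L B D T : ℝ} (hτ : 0 < τ) (hT : 0 ≤ T)
    (hD : D = B * Real.exp (-L * τ)) {z f : ℝ → ℝ} (hz : Continuous z) (hf : Continuous f)
    (hz' : ∀ t ∈ Ioo 0 T, HasDerivAt z (L * z t + B * z (t - τ) + f t) t) :
    z T = Real.exp (L * T) * delayedExp τ D (T - τ) * z 0
      + D * (∫ s in (-τ)..0, Real.exp (L * (T - s)) * delayedExp τ D (T - 2 * τ - s) * z s)
      + ∫ s in (0 : ℝ)..T, Real.exp (L * (T - s)) * delayedExp τ D (T - τ - s) * f s := by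
  set E := delayedExp τ D with hE
  have hi : ∀ (c : ℝ) {g : ℝ → ℝ}, Continuous g → ∀ x y,
      IntervalIntegrable (fun r => g r * E (r - c)) MeasureTheory.volume x y :=
    fun c g hg x y => intervalIntegrable_mul_delayedExp hτ hg c x y
  have c₁ : Continuous fun r => Real.exp (L * r) * z (T - r) := by fun_prop
  have c₂ : Continuous fun r => Real.exp (L * r) * z (T - r - τ) := by fun_prop
  have c₃ : Continuous fun r => Real.exp (L * r) * f (T - r) := by fun_prop
  -- Integrate the derivative of `e^{Lr} E(r - τ) z(T - r)`: the two terms with the factor `L`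
  -- cancel. Right derivatives suffice for the fundamental theorem.
  have hG : (∫ r in (0 : ℝ)..T, (D * (Real.exp (L * r) * z (T - r) * E (r - 2 * τ))
      - B * (Real.exp (L * r) * z (T - r - τ) * E (r - τ))
      - Real.exp (L * r) * f (T - r) * E (r - τ)))
      = Real.exp (L * T) * E (T - τ) * z (T - T) - Real.exp (L * 0) * E (0 - τ) * z (T - 0) := by
    refine intervalIntegral.integral_eq_sub_of_hasDeriv_right_of_le
      (f := fun r => Real.exp (L * r) * E (r - τ) * z (T - r)) hT ?_ ?_ ?_
    · exact ((by fun_prop : Continuous fun r => Real.exp (L * r)).continuousOn.mul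
        (continuousOn_delayedExp_sub hτ T)).mul (by fun_prop)
    · intro r hr
      have d₁ : HasDerivAt (fun r => Real.exp (L * r)) (Real.exp (L * r) * L) r := by
        simpa using ((hasDerivAt_id r).const_mul L).exp
      have d₂ := hasDerivWithinAt_delayedExp_sub (b := D) hτ hr.1.le
      have d₃ : HasDerivAt (fun r => z (T - r))
          (-(L * z (T - r) + B * z (T - r - τ) + f (T - r))) r := by
        have := (hz' (T - r) ⟨by linarith [hr.2], by linarith [hr.1]⟩).comp_const_sub T r
        simpa using this
      refine ((d₁.hasDerivWithinAt.mul d₂).mul d₃.hasDerivWithinAt).congr_deriv ?_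
      simp only [Pi.mul_apply, ← hE]
      ring
    · exact (((hi _ c₁ _ _).const_mul D).sub ((hi _ c₂ _ _).const_mul B)).sub (hi _ c₃ _ _)
  have hE0 : E (0 - τ) = 1 := delayedExp_of_neg hτ (by linarith) (by linarith)
  rw [intervalIntegral.integral_sub (((hi _ c₁ _ _).const_mul D).sub ((hi _ c₂ _ _).const_mul B))
      (hi _ c₃ _ _), intervalIntegral.integral_sub ((hi _ c₁ _ _).const_mul D)
      ((hi _ c₂ _ _).const_mul B), intervalIntegral.integral_const_mul,
    intervalIntegral.integral_const_mul, hE0] at hG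
  simp only [sub_self, sub_zero, mul_zero, Real.exp_zero, one_mul] at hG
  -- Shifting `r` by `τ` turns `B` into `D = B e^{-Lτ}`, so both delayed integrals acquire the same
  -- integrand.
  have hshift : B * (∫ r in (0 : ℝ)..T, Real.exp (L * r) * z (T - r - τ) * E (r - τ)) =
      D * ∫ r in τ..T + τ, Real.exp (L * r) * z (T - r) * E (r - 2 * τ) := by
    have := intervalIntegral.integral_comp_add_right (a := 0) (b := T)
      (fun r => Real.exp (L * r) * z (T - r) * E (r - 2 * τ)) τ
    rw [zero_add] at this
    rw [← this, ← intervalIntegral.integral_const_mul, ← intervalIntegral.integral_const_mul]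
    refine intervalIntegral.integral_congr fun r _ => ?_
    rw [hD, show r + τ - 2 * τ = r - τ by ring, show T - (r + τ) = T - r - τ by ring,
      show L * (r + τ) = L * r + L * τ by ring, Real.exp_add, show -L * τ = -(L * τ) by ring,
      Real.exp_neg]
    have := (Real.exp_pos (L * τ)).ne'
    field_simp
  -- Here `r - 2τ < -τ` except at the single point `r = τ`, where `E` is 1.
  have hzero : (∫ r in (0 : ℝ)..τ, Real.exp (L * r) * z (T - r) * E (r - 2 * τ)) = 0 := by
    rw [intervalIntegral.integral_congr_ae (g := fun _ => (0 : ℝ))]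
    · simp
    · have : ∀ᵐ r : ℝ ∂MeasureTheory.volume, r ≠ τ := MeasureTheory.Measure.ae_ne _ τ
      filter_upwards [this] with r hr hr'
      rw [uIoc_of_le hτ.le] at hr'
      rw [hE, delayedExp_of_lt (by linarith [lt_of_le_of_ne hr'.2 hr]), mul_zero]
  -- The integrals over `[τ, T + τ]` and `[0, T]` differ by those over `[T, T + τ]` and `[0, τ]`,
  -- whichever of `T`, `τ` is larger. The last one vanishes and the other is the history term.
  have hsplit := intervalIntegral.integral_interval_sub_interval_comm
    (hi (2 * τ) c₁ τ (T + τ)) (hi (2 * τ) c₁ 0 T) (hi (2 * τ) c₁ τ 0)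
  rw [intervalIntegral.integral_symm 0 τ, hzero] at hsplit
  have hhist : (∫ s in (-τ)..0, Real.exp (L * (T - s)) * E (T - 2 * τ - s) * z s) =
      ∫ r in T..T + τ, Real.exp (L * r) * z (T - r) * E (r - 2 * τ) := by
    have := intervalIntegral.integral_comp_sub_left (a := -τ) (b := 0)
      (fun r => Real.exp (L * r) * z (T - r) * E (r - 2 * τ)) T
    simp only [sub_neg_eq_add, sub_zero] at this
    rw [← this]
    refine intervalIntegral.integral_congr fun s _ => ?_
    simp only [sub_sub_cancel]
    rw [show T - s - 2 * τ = T - 2 * τ - s by ring]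
    ring
  have hsrc : (∫ s in (0 : ℝ)..T, Real.exp (L * (T - s)) * E (T - τ - s) * f s) =
      ∫ r in (0 : ℝ)..T, Real.exp (L * r) * f (T - r) * E (r - τ) := by
    have := intervalIntegral.integral_comp_sub_left (a := 0) (b := T)
      (fun r => Real.exp (L * r) * f (T - r) * E (r - τ)) T
    simp only [sub_self, sub_zero] at this
    rw [← this]
    refine intervalIntegral.integral_congr fun s _ => ?_
    simp only [sub_sub_cancel]
    rw [show T - s - τ = T - τ - s by ring]
    ring
  rw [hhist, hsrc]
  rw [hshift] at hG
  have : D * (∫ r in τ..T + τ, Real.exp (L * r) * z (T - r) * E (r - 2 * τ))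
      - D * (∫ r in (0 : ℝ)..T, Real.exp (L * r) * z (T - r) * E (r - 2 * τ))
      = D * ∫ r in T..T + τ, Real.exp (L * r) * z (T - r) * E (r - 2 * τ) := by
    rw [← mul_sub, hsplit, intervalIntegral.integral_symm T (T + τ)]
    ring
  linarith

/-! ### Method of steps for a scalar linear equation with delay -/

/-- The `k`-th iterate of the method of steps for `z'(t) = L z(t) + B z(t - τ) + f(t)` with
history `h`: it solves the equation on `[0, k τ]`. -/
noncomputable def delayIter (L B τ : ℝ) (h f : ℝ → ℝ) : ℕ → ℝ → ℝ
  | 0 => fun t => h (min t 0)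
  | k + 1 => fun t => h (min t 0) - h 0 + Real.exp (L * max t 0) *
      (h 0 + ∫ s in (0 : ℝ)..max t 0,
        Real.exp (-L * s) * (B * delayIter L B τ h f k (s - τ) + f s))

section

variable {L B τ : ℝ} {h f : ℝ → ℝ}

/-- The clamps glue the two regimes: `h (min t 0) - h 0` vanishes for `t ≥ 0`, and the Duhamel part
is constantly `h 0` for `t ≤ 0`. -/
theorem continuous_delayIter (hh : Continuous h) (hf : Continuous f) (k : ℕ) :
    Continuous (delayIter L B τ h f k) := by
  induction k with
  | zero => unfold delayIter; fun_prop
  | succ k ih =>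
    unfold delayIter
    have hi : Continuous fun s : ℝ =>
        Real.exp (-L * s) * (B * delayIter L B τ h f k (s - τ) + f s) := by fun_prop
    have hp : Continuous fun t : ℝ => ∫ s in (0 : ℝ)..t,
        Real.exp (-L * s) * (B * delayIter L B τ h f k (s - τ) + f s) :=
      intervalIntegral.continuous_primitive (fun a b => hi.intervalIntegrable a b) 0
    have hp' := hp.comp (by fun_prop : Continuous fun t : ℝ => max t 0)
    simp only [Function.comp_def] at hp'
    fun_prop

theorem delayIter_of_nonpos (k : ℕ) {t : ℝ} (ht : t ≤ 0) : delayIter L B τ h f k t = h t := by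
  cases k <;> simp [delayIter, ht]

theorem delayIter_succ_of_nonneg (k : ℕ) {t : ℝ} (ht : 0 ≤ t) :
    delayIter L B τ h f (k + 1) t = Real.exp (L * t) *
      (h 0 + ∫ s in (0 : ℝ)..t,
        Real.exp (-L * s) * (B * delayIter L B τ h f k (s - τ) + f s)) := by
  simp [delayIter, ht]

/-- Up to time `t` the integral only reads the previous iterate up to `t - τ`, so each step of the
induction extends the range of agreement by `τ`. -/
theorem delayIter_succ_eq (k : ℕ) {t : ℝ} (ht : t ≤ k * τ) :
    delayIter L B τ h f (k + 1) t = delayIter L B τ h f k t := by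
  induction k generalizing t with
  | zero =>
    have : t ≤ 0 := by simpa using ht
    rw [delayIter_of_nonpos _ this, delayIter_of_nonpos _ this]
  | succ k ih =>
    rcases le_total t 0 with h0 | h0
    · rw [delayIter_of_nonpos _ h0, delayIter_of_nonpos _ h0]
    · rw [delayIter_succ_of_nonneg _ h0, delayIter_succ_of_nonneg _ h0]
      congr 2
      refine intervalIntegral.integral_congr fun s hs => ?_
      rw [uIcc_of_le h0] at hs
      rw [ih]
      push_cast at ht
      linarith [hs.2]

/-- Differentiating Duhamel's formula produces the iterate `k` at `t - τ`. There it equals the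
iterate `k + 1`, so a single function satisfies the delay equation. -/
theorem hasDerivAt_delayIter (hh : Continuous h) (hf : Continuous f) (k : ℕ) {t : ℝ}
    (ht : t - τ ≤ k * τ) :
    HasDerivAt (fun t => Real.exp (L * t) * (h 0 + ∫ s in (0 : ℝ)..t,
        Real.exp (-L * s) * (B * delayIter L B τ h f k (s - τ) + f s)))
      (L * (Real.exp (L * t) * (h 0 + ∫ s in (0 : ℝ)..t,
        Real.exp (-L * s) * (B * delayIter L B τ h f k (s - τ) + f s)))
        + B * delayIter L B τ h f (k + 1) (t - τ) + f t) t := by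
  have hk := continuous_delayIter (L := L) (B := B) (τ := τ) hh hf k
  have hi : Continuous fun s : ℝ =>
      Real.exp (-L * s) * (B * delayIter L B τ h f k (s - τ) + f s) := by fun_prop
  have d₁ : HasDerivAt (fun r => Real.exp (L * r)) (Real.exp (L * t) * L) t := by
    simpa using ((hasDerivAt_id t).const_mul L).exp
  have d₂ := (hi.integral_hasStrictDerivAt 0 t).hasDerivAt.const_add (h 0)
  refine (d₁.mul d₂).congr_deriv ?_
  rw [delayIter_succ_eq k ht]
  have : Real.exp (L * t) * Real.exp (-L * t) = 1 := by
    rw [← Real.exp_add]; simp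
  linear_combination (B * delayIter L B τ h f k (t - τ) + f t) * this

theorem hasDerivWithinAt_delayIter (hh : Continuous h) (hf : Continuous f) (k : ℕ)
    {T t : ℝ} (ht : t ∈ Icc 0 T) (hkt : t - τ ≤ k * τ) :
    HasDerivWithinAt (delayIter L B τ h f (k + 1)) (L * delayIter L B τ h f (k + 1) t
        + B * delayIter L B τ h f (k + 1) (t - τ) + f t) (Icc 0 T) t := by
  have := (hasDerivAt_delayIter (L := L) (B := B) hh hf k hkt).hasDerivWithinAt (s := Icc 0 T)
  rw [← delayIter_succ_of_nonneg k ht.1] at this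
  exact this.congr (fun s hs => delayIter_succ_of_nonneg k hs.1)
    (delayIter_succ_of_nonneg k ht.1)

end

/-- A bound for the variation of constants formula. -/
theorem abs_duhamel_le {L c γ T t G a : ℝ} {g : ℝ → ℝ} (hγ : 0 < γ)
    (hc : 0 ≤ c) (hL : L ≤ c - γ) (ht : 0 ≤ t) (htT : t ≤ T)
    (hG : ∀ s ∈ Icc 0 t, |g s| ≤ G) :
    |Real.exp (L * t) * (a + ∫ s in (0 : ℝ)..t, Real.exp (-L * s) * g s)| ≤
      Real.exp (c * T) * (|a| + G / γ) := by
  have hG0 : 0 ≤ G := (abs_nonneg _).trans (hG 0 ⟨le_rfl, ht⟩)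
  -- Growth at rate `c` costs only the factor `e^{cT}`; the damping `e^{-γ(t-s)}` is kept because
  -- its integral is at most `1 / γ`.
  have hexp : ∀ s ∈ Icc 0 t, Real.exp (L * (t - s)) ≤ Real.exp (c * T) * Real.exp (-γ * (t - s)) :=
    fun s hs => by
      rw [← Real.exp_add]
      apply Real.exp_le_exp.2
      have h1 : L * (t - s) ≤ (c - γ) * (t - s) :=
        mul_le_mul_of_nonneg_right hL (by linarith [hs.2])
      have h2 : c * (t - s) ≤ c * T := mul_le_mul_of_nonneg_left (by linarith [hs.1]) hc
      linarith
  have h0 : Real.exp (L * t) ≤ Real.exp (c * T) := by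
    apply Real.exp_le_exp.2
    have h1 : L * t ≤ c * t := mul_le_mul_of_nonneg_right (by linarith) ht
    exact h1.trans (mul_le_mul_of_nonneg_left htT hc)
  have hint : |∫ s in (0 : ℝ)..t, Real.exp (L * (t - s)) * g s| ≤
      ∫ s in (0 : ℝ)..t, Real.exp (c * T) * G * Real.exp (-γ * (t - s)) := by
    rw [← Real.norm_eq_abs]
    refine intervalIntegral.norm_integral_le_of_norm_le ht ?_
      (Continuous.intervalIntegrable (by fun_prop) _ _)
    refine Eventually.of_forall fun s hs => ?_
    have hs' : s ∈ Icc 0 t := ⟨hs.1.le, hs.2⟩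
    rw [norm_mul, Real.norm_eq_abs, Real.norm_eq_abs, abs_of_pos (Real.exp_pos _)]
    calc Real.exp (L * (t - s)) * |g s|
        ≤ (Real.exp (c * T) * Real.exp (-γ * (t - s))) * G :=
          mul_le_mul (hexp s hs') (hG s hs') (abs_nonneg _) (by positivity)
      _ = _ := by ring
  have hval : (∫ s in (0 : ℝ)..t, Real.exp (c * T) * G * Real.exp (-γ * (t - s))) ≤
      Real.exp (c * T) * (G / γ) := by
    have : (∫ s in (0 : ℝ)..t, Real.exp (c * T) * G * Real.exp (-γ * (t - s))) =
        Real.exp (c * T) * G * Real.exp (-γ * (t - t)) / γ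
          - Real.exp (c * T) * G * Real.exp (-γ * (t - 0)) / γ := by
      refine intervalIntegral.integral_eq_sub_of_hasDerivAt
        (f := fun s => Real.exp (c * T) * G * Real.exp (-γ * (t - s)) / γ) (fun s _ => ?_)
        (Continuous.intervalIntegrable (by fun_prop) _ _)
      have d := ((((hasDerivAt_id s).const_sub t).const_mul (-γ)).exp.const_mul
        (Real.exp (c * T) * G)).div_const γ
      refine d.congr_deriv ?_
      simp only [id]
      field_simp
    rw [this]
    simp only [sub_self, mul_zero, Real.exp_zero, mul_one]
    have : 0 ≤ Real.exp (c * T) * G * Real.exp (-γ * (t - 0)) / γ := by positivity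
    rw [mul_div_assoc] at this ⊢
    simp only [mul_div_assoc, mul_assoc] at this ⊢
    linarith
  have hsplit : Real.exp (L * t) * (a + ∫ s in (0 : ℝ)..t, Real.exp (-L * s) * g s) =
      Real.exp (L * t) * a + ∫ s in (0 : ℝ)..t, Real.exp (L * (t - s)) * g s := by
    rw [mul_add, ← intervalIntegral.integral_const_mul]
    congr 2
    ext s
    rw [show L * (t - s) = L * t + -L * s by ring, Real.exp_add]
    ring
  rw [hsplit]
  calc _ ≤ |Real.exp (L * t) * a| + |∫ s in (0 : ℝ)..t, Real.exp (L * (t - s)) * g s| :=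
        abs_add_le _ _
    _ ≤ Real.exp (c * T) * |a| + Real.exp (c * T) * (G / γ) := by
        rw [abs_mul, abs_of_pos (Real.exp_pos _)]
        exact add_le_add (mul_le_mul_of_nonneg_right h0 (abs_nonneg _)) (hint.trans hval)
    _ = _ := by ring

/-- The iterates of the method of steps inherit the decay of the data. -/
theorem exists_abs_delayIter_le {c γ β τ T A F : ℝ} (hγ : 0 < γ) (hc : 0 ≤ c) (hβ : 0 ≤ β)
    (hA : 0 ≤ A) (hF : 0 ≤ F) (hτ : 0 < τ) (k : ℕ) :
    ∃ C, 0 ≤ C ∧ ∀ (ν L B : ℝ) (h f : ℝ → ℝ), 0 < ν → Continuous h → Continuous f →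
      L ≤ c - γ * ν → |B| ≤ β * ν → (∀ s, |h s| ≤ A / ν ^ 2) →
      (∀ s ∈ Icc 0 T, |f s| ≤ F / ν) → ∀ t ≤ T, |delayIter L B τ h f k t| ≤ C / ν ^ 2 := by
  induction k with
  | zero => exact ⟨A, hA, fun ν L B h f hν hh hf hL hB hhA hfF t ht => hhA _⟩
  | succ k ih =>
    obtain ⟨C, hC, ih⟩ := ih
    refine ⟨A + Real.exp (c * T) * (A + (β * C + F) / γ), by positivity,
      fun ν L B h f hν hh hf hL hB hhA hfF t ht => ?_⟩
    have hk := continuous_delayIter (L := L) (B := B) (τ := τ) hh hf k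
    rcases le_total t 0 with h0 | h0
    · rw [delayIter_of_nonpos _ h0]
      refine (hhA t).trans (div_le_div_of_nonneg_right ?_ (by positivity))
      have : 0 ≤ Real.exp (c * T) * (A + (β * C + F) / γ) := by positivity
      linarith
    · rw [delayIter_succ_of_nonneg _ h0]
      -- `B` of order `ν` lowers the decay `ν⁻²` of the previous iterate to `ν⁻¹`, the order of `f`;
      -- the factor `1 / (γν)` from Duhamel's formula restores `ν⁻²`.
      have hG : ∀ s ∈ Icc 0 t, |B * delayIter L B τ h f k (s - τ) + f s| ≤ (β * C + F) / ν := by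
        intro s hs
        calc _ ≤ |B * delayIter L B τ h f k (s - τ)| + |f s| := abs_add_le _ _
          _ ≤ (β * ν) * (C / ν ^ 2) + F / ν := by
              rw [abs_mul]
              refine add_le_add (mul_le_mul hB ?_ (abs_nonneg _) (by positivity))
                (hfF s ⟨hs.1, hs.2.trans ht⟩)
              exact ih ν L B h f hν hh hf hL hB hhA hfF _ (by linarith [hs.2])
          _ = (β * C + F) / ν := by field_simp
      refine (abs_duhamel_le (mul_pos hγ hν) hc hL h0 ht hG).trans ?_
      calc Real.exp (c * T) * (|h 0| + (β * C + F) / ν / (γ * ν))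
          ≤ Real.exp (c * T) * (A / ν ^ 2 + (β * C + F) / ν / (γ * ν)) := by
            gcongr; exact hhA 0
        _ = (Real.exp (c * T) * (A + (β * C + F) / γ)) / ν ^ 2 := by field_simp
        _ ≤ _ := div_le_div_of_nonneg_right (by linarith) (by positivity)

/-! ### Sine series -/

theorem integral_symm_eq_integral_add_neg {l : ℝ} {f : ℝ → ℂ} (hf : Continuous f) :
    (∫ x in (-l)..l, f x) = ∫ x in (0 : ℝ)..l, (f x + f (-x)) := by
  rw [← intervalIntegral.integral_add_adjacent_intervals (b := 0) (hf.intervalIntegrable _ _)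
    (hf.intervalIntegrable _ _), intervalIntegral.integral_add (hf.intervalIntegrable _ _)
    ((show Continuous fun x => f (-x) from hf.comp continuous_neg).intervalIntegrable _ _),
    add_comm]
  congr 1
  have := intervalIntegral.integral_comp_neg (a := 0) (b := l) f
  simp only [neg_zero] at this
  exact this.symm

theorem ofReal_mul_sin (a θ : ℝ) : ((a * Real.sin θ : ℝ) : ℂ) =
    a * ((Complex.exp (-θ * Complex.I) - Complex.exp (θ * Complex.I)) * Complex.I / 2) := by
  rw [Complex.ofReal_mul, Complex.ofReal_sin, Complex.sin]

/-- The `n`-th Fourier coefficient of the odd extension, for integral `n`. -/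
theorem fourierCoeff_odd {l : ℝ} (hl : 0 < l) {o : ℝ → ℝ} (ho : Continuous o)
    (hodd : ∀ x, o (-x) = -o x) (n : ℤ) :
    haveI := Fact.mk (by linarith : 0 < 2 * l)
    fourierCoeff (AddCircle.liftIco (2 * l) (-l) fun x => (o x : ℂ)) n =
      -(Complex.I / l) * ((∫ x in (0 : ℝ)..l, o x * Real.sin (Real.pi * n / l * x) : ℝ) : ℂ) := by
  have := Fact.mk (by linarith : 0 < 2 * l)
  have hl' : (l : ℂ) ≠ 0 := by exact_mod_cast hl.ne'
  rw [fourierCoeff_liftIco_eq, fourierCoeffOn_eq_integral]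
  have hend : -l + 2 * l = l := by ring
  have hper : -l + 2 * l - -l = 2 * l := by ring
  have hexp : ∀ x : ℝ, (fourier (-n) (x : AddCircle (-l + 2 * l - -l)) : ℂ) =
      Complex.exp (-((Real.pi * n / l * x : ℝ) : ℂ) * Complex.I) := by
    intro x
    rw [fourier_coe_apply, hper]
    congr 1
    push_cast
    field_simp
  simp only [hexp]
  rw [show (∫ x in (-l)..(-l + 2 * l), Complex.exp (-((Real.pi * n / l * x : ℝ) : ℂ) * Complex.I)
      • (o x : ℂ)) = ∫ x in (-l)..l, Complex.exp (-((Real.pi * n / l * x : ℝ) : ℂ) * Complex.I)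
      • (o x : ℂ) by rw [hend], integral_symm_eq_integral_add_neg (by fun_prop)]
  have hsin : ∀ x : ℝ, Complex.exp (-((Real.pi * n / l * x : ℝ) : ℂ) * Complex.I) • (o x : ℂ)
      + Complex.exp (-((Real.pi * n / l * (-x) : ℝ) : ℂ) * Complex.I) • (o (-x) : ℂ)
      = -2 * Complex.I * ((o x * Real.sin (Real.pi * n / l * x) : ℝ) : ℂ) := by
    intro x
    rw [hodd, ofReal_mul_sin]
    generalize hθ : Real.pi * n / l * x = θ
    rw [show Real.pi * n / l * (-x) = -θ by rw [← hθ]; ring]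
    push_cast
    simp only [smul_eq_mul, neg_neg]
    linear_combination (((Complex.exp (-θ * Complex.I) - Complex.exp (θ * Complex.I)) *
      (o x : ℂ))) * Complex.I_sq
  simp only [hsin]
  rw [intervalIntegral.integral_const_mul, intervalIntegral.integral_ofReal, hper,
    Complex.real_smul]
  push_cast
  field_simp

/-- A continuous function on `[0, l]` that vanishes at both ends is the sum of its sine series, if
the coefficients of that series are summable. -/
theorem hasSum_sine_series {l : ℝ} (hl : 0 < l) {g : ℝ → ℝ} (hg : ContinuousOn g (Icc 0 l))
    (hg0 : g 0 = 0) (hgl : g l = 0) (hs : Summable fun n : ℕ => sineCoeff l (n + 1) g) {x : ℝ}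
    (hx : x ∈ Icc 0 l) :
    HasSum (fun n : ℕ => sineCoeff l (n + 1) g * Real.sin (Real.pi * ((n + 1 : ℕ) : ℝ) / l * x))
      (g x) := by
  -- The circle is parametrised by `[-l, l)`, so `x = l` is separate; all sines vanish there.
  rcases eq_or_lt_of_le hx.2 with rfl | hxl
  · rw [hgl]
    convert hasSum_zero with n
    rw [div_mul_cancel₀ _ hl.ne', mul_comm Real.pi, Real.sin_nat_mul_pi, mul_zero]
  have := Fact.mk (by linarith : 0 < 2 * l)
  have hle : (0 : ℝ) ≤ l := hl.le
  -- The constant extension vanishes on the negative axis because `g 0 = 0`, so `e y - e (-y)` is a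
  -- continuous odd function extending `g`. As `g l = 0`, it takes equal values at `±l` and descends
  -- to the circle.
  set e : ℝ → ℝ := IccExtend hle ((Icc 0 l).domRestrict g) with he
  have hec : Continuous e := (continuousOn_iff_continuous_domRestrict.1 hg).Icc_extend'
  have he_mem : ∀ y ∈ Icc 0 l, e y = g y := fun y hy => IccExtend_of_mem hle _ hy
  have he_neg : ∀ y ≤ 0, e y = 0 := fun y hy => by
    rw [he, IccExtend_of_le_left hle _ hy]; exact hg0
  set o : ℝ → ℝ := fun y => e y - e (-y) with ho
  have hoc : Continuous o := by fun_prop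
  have hodd : ∀ y, o (-y) = -o y := fun y => by simp [ho]
  have ho_mem : ∀ y ∈ Icc 0 l, o y = g y := fun y hy => by
    simp [ho, he_mem y hy, he_neg (-y) (by linarith [hy.1])]
  have hol : o l = 0 := by rw [ho_mem l ⟨hle, le_rfl⟩, hgl]
  have hcirc : Continuous (AddCircle.liftIco (2 * l) (-l) fun x => (o x : ℂ)) := by
    refine AddCircle.liftIco_continuous ?_ (by fun_prop)
    rw [show -l + 2 * l = l by ring, hodd, hol]; simp
  set F : C(AddCircle (2 * l), ℂ) := ⟨_, hcirc⟩ with hF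
  have hl' : (l : ℂ) ≠ 0 := by exact_mod_cast hl.ne'
  have hcoef : ∀ n : ℤ, fourierCoeff F n =
      -(Complex.I / l) * ((∫ x in (0 : ℝ)..l, o x * Real.sin (Real.pi * n / l * x) : ℝ) : ℂ) :=
    fourierCoeff_odd hl hoc hodd
  have hnat : ∀ n : ℕ, fourierCoeff F n = -(Complex.I / 2) * (sineCoeff l n g : ℂ) := by
    intro n
    rw [hcoef, sineCoeff]
    rw [intervalIntegral.integral_congr (g := fun ξ => g ξ * Real.sin (Real.pi * n / l * ξ))]
    · push_cast
      field_simp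
    · intro y hy
      rw [uIcc_of_le hle] at hy
      simp [ho_mem y hy]
  have hneg : ∀ n : ℕ, fourierCoeff F (-n) = Complex.I / 2 * (sineCoeff l n g : ℂ) := by
    intro n
    have h1 := hcoef (-n)
    have h2 := hcoef n
    rw [hnat] at h2
    have : (∫ x in (0 : ℝ)..l, o x * Real.sin (Real.pi * ((-n : ℤ) : ℝ) / l * x)) =
        -∫ x in (0 : ℝ)..l, o x * Real.sin (Real.pi * ((n : ℤ) : ℝ) / l * x) := by
      rw [← intervalIntegral.integral_neg]
      congr 1; ext y
      rw [show Real.pi * ((-n : ℤ) : ℝ) / l * y = -(Real.pi * ((n : ℤ) : ℝ) / l * y) by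
        push_cast; ring, Real.sin_neg, mul_neg]
    rw [h1, this]
    push_cast at h2 ⊢
    linear_combination h2
  have hsC : Summable fun n : ℕ => (sineCoeff l n g : ℂ) :=
    (summable_nat_add_iff 1).1 (by exact_mod_cast hs)
  have hsum : Summable (fourierCoeff F) := by
    refine Summable.of_nat_of_neg ?_ ?_
    · simpa only [hnat] using hsC.mul_left _
    · simpa only [hneg] using hsC.mul_left _
  have hfs := (has_pointwise_sum_fourier_series_of_summable hsum (x : AddCircle (2 * l))).nat_add_neg
  have hFx : F (x : AddCircle (2 * l)) = (g x : ℂ) := by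
    rw [← ho_mem x hx]
    exact AddCircle.liftIco_coe_apply (f := fun x => (o x : ℂ))
      ⟨by linarith [hx.1], by linarith⟩
  have hcast : ∀ n : ℕ, fourierCoeff F n • fourier (n : ℤ) (x : AddCircle (2 * l))
      + fourierCoeff F (-n) • fourier (-n : ℤ) (x : AddCircle (2 * l)) =
      ((sineCoeff l n g * Real.sin (Real.pi * n / l * x) : ℝ) : ℂ) := by
    intro n
    rw [hnat, hneg, fourier_coe_apply, fourier_coe_apply, ofReal_mul_sin]
    rw [show 2 * (Real.pi : ℂ) * Complex.I * ((n : ℤ) : ℂ) * x / ((2 * l : ℝ) : ℂ) =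
        ((Real.pi * n / l * x : ℝ) : ℂ) * Complex.I by push_cast; field_simp,
      show 2 * (Real.pi : ℂ) * Complex.I * ((-n : ℤ) : ℂ) * x / ((2 * l : ℝ) : ℂ) =
        -((Real.pi * n / l * x : ℝ) : ℂ) * Complex.I by push_cast; field_simp]
    simp only [smul_eq_mul]
    ring
  simp only [hcast, hFx] at hfs
  -- Pairing `n` with `-n` counts the index 0 twice; its coefficient is zero.
  have hzero : fourierCoeff F 0 • fourier 0 (x : AddCircle (2 * l)) = 0 := by
    have := hnat 0
    simp only [Nat.cast_zero] at this
    simp [this, sineCoeff]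
  rw [hzero, add_zero] at hfs
  have hfs' : HasSum (fun n : ℕ => sineCoeff l n g * Real.sin (Real.pi * n / l * x)) (g x) := by
    exact_mod_cast hfs
  rw [← hasSum_nat_add_iff' 1] at hfs'
  simpa [sineCoeff] using hfs'

/-! ### The maximum principle and uniqueness -/

/-- If `s > 0`, the second derivative test makes `x` a local minimum as well, so `f` is locally
constant and `s = 0`. -/
theorem second_deriv_nonpos_of_isLocalMax {f f' : ℝ → ℝ} {x s : ℝ}
    (hf : ∀ᶠ y in 𝓝 x, HasDerivAt f (f' y) y) (hf' : HasDerivAt f' s x) (hmax : IsLocalMax f x) :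
    s ≤ 0 := by
  by_contra! hs
  have hd : deriv f =ᶠ[𝓝 x] f' := hf.mono fun y hy => hy.deriv
  have hdd : deriv (deriv f) x = s := by rw [hd.deriv_eq, hf'.deriv]
  have hmin : IsLocalMin f x :=
    isLocalMin_of_deriv_deriv_pos (by rw [hdd]; exact hs) hmax.deriv_eq_zero
      hf.self_of_nhds.continuousAt
  have hconst : f =ᶠ[𝓝 x] fun _ => f x := by
    filter_upwards [hmax, hmin] with y h1 h2 using le_antisymm h1 h2
  have h0 : deriv f =ᶠ[𝓝 x] fun _ => 0 := by
    filter_upwards [hconst.eventuallyEq_nhds] with y hy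
    rw [hy.deriv_eq, deriv_const]
  have : deriv (deriv f) x = 0 := by rw [h0.deriv_eq, deriv_const]
  linarith

/-- From `t` the direction towards 0 stays in the interval, and the derivative along it cannot be
positive. This covers the end point `t = S`. -/
theorem deriv_nonneg_of_isMaxOn_Icc {f : ℝ → ℝ} {S t d : ℝ}
    (ht : t ∈ Ioc 0 S) (hf : HasDerivWithinAt f d (Icc 0 S) t) (hmax : IsMaxOn f (Icc 0 S) t) :
    0 ≤ d := by
  have hmem : (0 : ℝ) - t ∈ posTangentConeAt (Icc 0 S) t :=
    sub_mem_posTangentConeAt_of_segment_subset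
      ((convex_Icc 0 S).segment_subset ⟨ht.1.le, ht.2⟩ ⟨le_rfl, ht.1.le.trans ht.2⟩)
  have := IsLocalMaxOn.hasFDerivWithinAt_nonpos hmax.localize hf.hasFDerivWithinAt hmem
  simp at this
  exact nonneg_of_mul_nonneg_right this ht.1

/-- The weak maximum principle for `wₜ = a² wₓₓ + c w` with zero data. -/
theorem heat_nonpos {l S a c : ℝ} {w wt wx wxx : ℝ → ℝ → ℝ}
    (hw : ContinuousOn (Function.uncurry w) (Icc 0 l ×ˢ Icc 0 S))
    (ht : ∀ x ∈ Icc 0 l, ∀ t ∈ Icc 0 S, HasDerivWithinAt (fun s => w x s) (wt x t) (Icc 0 S) t)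
    (hx : ∀ x ∈ Icc 0 l, ∀ t ∈ Icc 0 S,
      HasDerivWithinAt (fun y => w y t) (wx x t) (Icc 0 l) x ∧
      HasDerivWithinAt (fun y => wx y t) (wxx x t) (Icc 0 l) x)
    (heq : ∀ x ∈ Icc 0 l, ∀ t ∈ Icc 0 S, wt x t = a ^ 2 * wxx x t + c * w x t)
    (h0 : ∀ x ∈ Icc 0 l, w x 0 = 0) (hb : ∀ t ∈ Icc 0 S, w 0 t = 0 ∧ w l t = 0) :
    ∀ x ∈ Icc 0 l, ∀ t ∈ Icc 0 S, w x t ≤ 0 := by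
  intro x₁ hx₁ t₁ ht₁
  by_contra! hpos
  -- With the weight `e^{-(c+1)t}`, a positive maximum forces `w_t ≥ (c + 1) w` and `w_xx ≤ 0`,
  -- hence `(c + 1) w ≤ c w`, which is absurd.
  have hW : ContinuousOn (fun p : ℝ × ℝ => Real.exp (-(c + 1) * p.2) * Function.uncurry w p)
      (Icc 0 l ×ˢ Icc 0 S) := ContinuousOn.mul (by fun_prop) hw
  obtain ⟨⟨x, t⟩, ⟨hxm, htm⟩, hmax⟩ :=
    (isCompact_Icc.prod isCompact_Icc).exists_isMaxOn ⟨(x₁, t₁), hx₁, ht₁⟩ hW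
  simp only at hxm htm
  have hwpos : 0 < w x t := by
    have h1 : Real.exp (-(c + 1) * t₁) * w x₁ t₁ ≤ Real.exp (-(c + 1) * t) * w x t :=
      hmax (show (x₁, t₁) ∈ Icc 0 l ×ˢ Icc 0 S from ⟨hx₁, ht₁⟩)
    have h2 : 0 < Real.exp (-(c + 1) * t₁) * w x₁ t₁ := by positivity
    exact pos_of_mul_pos_right (h2.trans_le h1) (Real.exp_pos _).le
  have hx0 : 0 < x := lt_of_le_of_ne hxm.1 fun h => by
    rw [← h, (hb t htm).1] at hwpos; exact lt_irrefl _ hwpos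
  have hxl : x < l := lt_of_le_of_ne hxm.2 fun h => by
    rw [h, (hb t htm).2] at hwpos; exact lt_irrefl _ hwpos
  have ht0 : 0 < t := lt_of_le_of_ne htm.1 fun h => by
    rw [← h, h0 x hxm] at hwpos; exact lt_irrefl _ hwpos
  have hwxx : wxx x t ≤ 0 := by
    refine second_deriv_nonpos_of_isLocalMax (f := fun y => w y t) (f' := fun y => wx y t) ?_
      ((hx x hxm t htm).2.hasDerivAt (Icc_mem_nhds hx0 hxl)) ?_
    · filter_upwards [Ioo_mem_nhds hx0 hxl] with y hy
      exact (hx y ⟨hy.1.le, hy.2.le⟩ t htm).1.hasDerivAt (Icc_mem_nhds hy.1 hy.2)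
    · filter_upwards [Icc_mem_nhds hx0 hxl] with y hy
      have h1 : Real.exp (-(c + 1) * t) * w y t ≤ Real.exp (-(c + 1) * t) * w x t :=
        hmax (show (y, t) ∈ Icc 0 l ×ˢ Icc 0 S from ⟨hy, htm⟩)
      exact le_of_mul_le_mul_left h1 (Real.exp_pos _)
  have hwt : 0 ≤ Real.exp (-(c + 1) * t) * (-(c + 1)) * w x t
      + Real.exp (-(c + 1) * t) * wt x t := by
    refine deriv_nonneg_of_isMaxOn_Icc (f := fun s => Real.exp (-(c + 1) * s) * w x s)
      ⟨ht0, htm.2⟩ ?_ fun s hs => hmax (show (x, s) ∈ Icc 0 l ×ˢ Icc 0 S from ⟨hxm, hs⟩)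
    have d : HasDerivAt (fun s => Real.exp (-(c + 1) * s))
        (Real.exp (-(c + 1) * t) * (-(c + 1))) t := by
      simpa using ((hasDerivAt_id t).const_mul (-(c + 1))).exp
    exact d.hasDerivWithinAt.mul (ht x hxm t htm)
  have h2 : 0 ≤ Real.exp (-(c + 1) * t) * (wt x t - (c + 1) * w x t) := by linarith
  have h3 := nonneg_of_mul_nonneg_right h2 (Real.exp_pos _)
  rw [heq x hxm t htm] at h3
  have : a ^ 2 * wxx x t ≤ 0 := mul_nonpos_of_nonneg_of_nonpos (sq_nonneg a) hwxx
  linarith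

/-- Agreement up to `kτ` includes agreement of the second space derivatives, since derivatives
within `[0, l]` are unique. All delayed terms then cancel up to `(k + 1)τ`, and `heat_nonpos` is
applied to both signs of the difference. -/
theorem IsClassicalSolution.unique {P : Params} (hl : 0 < P.l) (hτ : 0 < P.τ)
    {f φ : ℝ → ℝ → ℝ} {μ₁ μ₂ : ℝ → ℝ} {u v : ℝ → ℝ → ℝ}
    (hu : IsClassicalSolution P f φ μ₁ μ₂ u) (hv : IsClassicalSolution P f φ μ₁ μ₂ v) :
    ∀ x ∈ Icc 0 P.l, ∀ t ∈ Icc (-P.τ) P.T, v x t = u x t := by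
  obtain ⟨ut, ux, uxx, huc, -, -, hut, hux, hueq, huφ, huμ⟩ := hu
  obtain ⟨vt, vx, vxx, hvc, -, -, hvt, hvx, hveq, hvφ, hvμ⟩ := hv
  have key : ∀ k : ℕ, ∀ t ∈ Icc (-P.τ) P.T, t ≤ k * P.τ → ∀ x ∈ Icc 0 P.l, v x t = u x t := by
    intro k
    induction k with
    | zero =>
      intro t ht h x hx
      have h : t ≤ 0 := by simpa using h
      rw [hvφ x hx t ⟨ht.1, h⟩, huφ x hx t ⟨ht.1, h⟩]
    | succ k ih =>
      intro t ht h x hx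
      rcases le_total t 0 with h0 | h0
      · rw [hvφ x hx t ⟨ht.1, h0⟩, huφ x hx t ⟨ht.1, h0⟩]
      push_cast at h
      have hsub : Icc 0 t ⊆ Icc 0 P.T := Icc_subset_Icc le_rfl ht.2
      have hsub' : Icc 0 t ⊆ Icc (-P.τ) P.T := Icc_subset_Icc (by linarith) ht.2
      have hdx : ∀ s ∈ Icc (-P.τ) P.T, s ≤ k * P.τ → ∀ y ∈ Icc 0 P.l, vxx y s = uxx y s := by
        intro s hs hsk y hy
        have hU := uniqueDiffOn_Icc hl
        have h1 : ∀ y ∈ Icc 0 P.l, vx y s = ux y s := fun y hy =>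
          (hU y hy).eq_deriv _ (hvx y hy s hs).1
            ((hux y hy s hs).1.congr (fun z hz => ih s hs hsk z hz) (ih s hs hsk y hy))
        exact (hU y hy).eq_deriv _ (hvx y hy s hs).2 ((hux y hy s hs).2.congr h1 (h1 y hy))
      have heq : ∀ y ∈ Icc 0 P.l, ∀ s ∈ Icc 0 t, vt y s - ut y s =
          P.a₁ ^ 2 * (vxx y s - uxx y s) + P.c₁ * (v y s - u y s) := by
        intro y hy s hs
        have hsd : s - P.τ ∈ Icc (-P.τ) P.T := ⟨by linarith [hs.1], by linarith [hs.2, ht.2]⟩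
        have hsk : s - P.τ ≤ k * P.τ := by linarith [hs.2]
        rw [hveq y hy s (hsub hs), hueq y hy s (hsub hs), hdx _ hsd hsk y hy, ih _ hsd hsk y hy]
        ring
      have hcv := hvc.mono (prod_mono (Subset.refl (Icc 0 P.l)) hsub')
      have hcu := huc.mono (prod_mono (Subset.refl (Icc 0 P.l)) hsub')
      have h1 := heat_nonpos (a := P.a₁) (c := P.c₁) (w := fun x t => v x t - u x t) (wt := fun x t => vt x t - ut x t)
        (wx := fun x t => vx x t - ux x t) (wxx := fun x t => vxx x t - uxx x t)
        (hcv.sub hcu)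
        (fun y hy s hs => ((hvt y hy s (hsub hs)).sub (hut y hy s (hsub hs))).mono hsub)
        (fun y hy s hs => ⟨(hvx y hy s (hsub' hs)).1.sub (hux y hy s (hsub' hs)).1,
          (hvx y hy s (hsub' hs)).2.sub (hux y hy s (hsub' hs)).2⟩) heq
        (fun y hy => by
          rw [hvφ y hy 0 ⟨by linarith, le_rfl⟩, huφ y hy 0 ⟨by linarith, le_rfl⟩, sub_self])
        (fun s hs => by simp [hvμ s (hsub' hs), huμ s (hsub' hs)]) x hx t ⟨h0, le_rfl⟩
      have h2 := heat_nonpos (a := P.a₁) (c := P.c₁) (w := fun x t => u x t - v x t) (wt := fun x t => ut x t - vt x t)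
        (wx := fun x t => ux x t - vx x t) (wxx := fun x t => uxx x t - vxx x t)
        (hcu.sub hcv)
        (fun y hy s hs => ((hut y hy s (hsub hs)).sub (hvt y hy s (hsub hs))).mono hsub)
        (fun y hy s hs => ⟨(hux y hy s (hsub' hs)).1.sub (hvx y hy s (hsub' hs)).1,
          (hux y hy s (hsub' hs)).2.sub (hvx y hy s (hsub' hs)).2⟩)
        (fun y hy s hs => by linarith [heq y hy s hs])
        (fun y hy => by
          rw [hvφ y hy 0 ⟨by linarith, le_rfl⟩, huφ y hy 0 ⟨by linarith, le_rfl⟩, sub_self])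
        (fun s hs => by simp [hvμ s (hsub' hs), huμ s (hsub' hs)]) x hx t ⟨h0, le_rfl⟩
      linarith
  intro x hx t ht
  obtain ⟨k, hk⟩ := exists_nat_gt (t / P.τ)
  exact key k t ht ((div_lt_iff₀ hτ).1 hk).le x hx

/-! ### Fourier coefficients of the data -/

theorem sineCoeff_affine {l : ℝ} (hl : 0 < l) {n : ℕ} (hn : 1 ≤ n) (A B : ℝ) :
    sineCoeff l n (fun ξ => A + ξ / l * (B - A)) = 2 / (Real.pi * n) * (A - (-1) ^ n * B) := by
  have hn' : (n : ℝ) ≠ 0 := by positivity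
  have hπ := Real.pi_ne_zero
  have hl' := hl.ne'
  set k : ℝ := Real.pi * n / l with hk
  have hk0 : k ≠ 0 := by positivity
  have hint : (∫ ξ in (0 : ℝ)..l, (A + ξ / l * (B - A)) * Real.sin (k * ξ)) =
      (-(A + l / l * (B - A)) * Real.cos (k * l) / k + (B - A) / l * Real.sin (k * l) / k ^ 2)
      - (-(A + 0 / l * (B - A)) * Real.cos (k * 0) / k + (B - A) / l * Real.sin (k * 0) / k ^ 2) := by
    refine intervalIntegral.integral_eq_sub_of_hasDerivAt (f := fun ξ =>
      -(A + ξ / l * (B - A)) * Real.cos (k * ξ) / k + (B - A) / l * Real.sin (k * ξ) / k ^ 2)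
      (fun ξ _ => ?_) (Continuous.intervalIntegrable (by fun_prop) _ _)
    have d₀ : HasDerivAt (fun ξ : ℝ => k * ξ) k ξ := by
      simpa using (hasDerivAt_id ξ).const_mul k
    have d₁ : HasDerivAt (fun ξ : ℝ => -(A + ξ / l * (B - A))) (-(1 / l * (B - A))) ξ :=
      ((((hasDerivAt_id ξ).div_const l).mul_const (B - A)).const_add A).neg
    refine (((d₁.mul d₀.cos).div_const k).add
      ((d₀.sin.const_mul ((B - A) / l)).div_const (k ^ 2))).congr_deriv ?_
    field_simp
    ring
  have hkl : k * l = n * Real.pi := by rw [hk]; field_simp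
  rw [sineCoeff, hint, hkl, Real.sin_nat_mul_pi, Real.cos_nat_mul_pi]
  simp only [mul_zero, Real.sin_zero, Real.cos_zero, hk]
  field_simp
  ring

theorem mCoeff_eq {P : Params} (hl : 0 < P.l) (μ₁ μ₂ : ℝ → ℝ) {n : ℕ} (hn : 1 ≤ n) (t : ℝ) :
    mCoeff P μ₁ μ₂ n t = 2 / (Real.pi * n) * (μ₁ t - (-1) ^ n * μ₂ t) :=
  sineCoeff_affine hl hn _ _

/-- The defect `-μ'(t) + c₁ μ(t) + c₂ μ(t - τ)` of boundary data. -/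
noncomputable def boundaryDefect (P : Params) (μ : ℝ → ℝ) (t : ℝ) : ℝ :=
  -derivWithin μ (Icc 0 P.T) t + P.c₁ * μ t + P.c₂ * μ (t - P.τ)

theorem MCoeff_eq {P : Params} (hl : 0 < P.l) (μ₁ μ₂ : ℝ → ℝ) {n : ℕ} (hn : 1 ≤ n) (t : ℝ) :
    MCoeff P μ₁ μ₂ n t =
      2 / (Real.pi * n) * (boundaryDefect P μ₁ t - (-1) ^ n * boundaryDefect P μ₂ t) := by
  have h : (fun ξ => -lift P (derivWithin μ₁ (Icc 0 P.T)) (derivWithin μ₂ (Icc 0 P.T)) ξ t) =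
      fun ξ => -derivWithin μ₁ (Icc 0 P.T) t
        + ξ / P.l * (-derivWithin μ₂ (Icc 0 P.T) t - -derivWithin μ₁ (Icc 0 P.T) t) := by
    ext ξ; rw [lift]; ring
  rw [MCoeff, h, sineCoeff_affine hl hn, mCoeff_eq hl _ _ hn, mCoeff_eq hl _ _ hn, boundaryDefect,
    boundaryDefect]
  ring

theorem continuousOn_boundaryDefect {P : Params} (hτ : 0 < P.τ) (hT : 0 < P.T) {μ : ℝ → ℝ}
    (hμ : ContinuousOn μ (Icc (-P.τ) P.T)) (hμ' : ContDiffOn ℝ 1 μ (Icc 0 P.T)) :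
    ContinuousOn (boundaryDefect P μ) (Icc 0 P.T) := by
  have h1 : ContinuousOn (derivWithin μ (Icc 0 P.T)) (Icc 0 P.T) :=
    hμ'.continuousOn_derivWithin (uniqueDiffOn_Icc hT) le_rfl
  have h2 : ContinuousOn μ (Icc 0 P.T) := hμ.mono (Icc_subset_Icc (by linarith) le_rfl)
  have h3 : ContinuousOn (fun t => μ (t - P.τ)) (Icc 0 P.T) :=
    hμ.comp (by fun_prop) fun t ht => ⟨by linarith [ht.1], by linarith [ht.2]⟩
  exact (h1.neg.add (h2.const_mul _)).add (h3.const_mul _)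

/-! ### Bounds drawn from the decay hypotheses, and vanishing of the boundary defects -/

theorem le_m_mul {P : Params} (hτ : 0 < P.τ) : P.T ≤ P.m * P.τ :=
  (div_le_iff₀ hτ).1 (Nat.le_ceil _)

theorem exists_mem_piece {P : Params} (hτ : 0 < P.τ) (hT : 0 < P.T) {s : ℝ} (hs : s ∈ Icc 0 P.T) :
    ∃ k ∈ Finset.Icc 1 P.m, s ∈ P.piece k := by
  have hm : 1 ≤ P.m := Nat.one_le_ceil_iff.2 (div_pos hT hτ)
  have hle : s ≤ ⌈s / P.τ⌉₊ * P.τ := (div_le_iff₀ hτ).1 (Nat.le_ceil _)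
  have hcm : ⌈s / P.τ⌉₊ ≤ P.m := Nat.ceil_mono (div_le_div_of_nonneg_right hs.2 hτ.le)
  -- The ceiling is 0 only for `s = 0`, which belongs to the first interval.
  rcases Nat.eq_zero_or_pos ⌈s / P.τ⌉₊ with h0 | h0
  · refine ⟨1, Finset.mem_Icc.2 ⟨le_rfl, hm⟩, ?_, le_min ?_ hs.2⟩
    · simpa using hs.1
    · rw [h0] at hle
      push_cast at hle ⊢
      linarith
  · refine ⟨_, Finset.mem_Icc.2 ⟨h0, hcm⟩, ?_, le_min hle hs.2⟩
    have h1 := Nat.ceil_lt_add_one (div_nonneg hs.1 hτ.le)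
    have h2 : (⌈s / P.τ⌉₊ : ℝ) - 1 ≤ s / P.τ := by linarith
    exact (le_div_iff₀ hτ).1 h2

/-- Since `k ≤ m`, the weight `n^{2(m-k)+1+δ}` is at least 1 and may be dropped; finitely many
intervals cover `[0, T]`. -/
theorem SourceDecay.eventually_le {P : Params} (hτ : 0 < P.τ) (hT : 0 < P.T) {δ : ℝ} (hδ : 0 < δ)
    {Fn : ℕ → ℝ → ℝ} (h : SourceDecay P δ Fn) :
    ∀ᶠ n : ℕ in atTop, ∀ s ∈ Icc 0 P.T, (n : ℝ) ^ 2 * |Fn n s| ≤ 1 := by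
  have h1 : ∀ k ∈ Finset.Icc 1 P.m, ∀ᶠ n : ℕ in atTop, ∀ s ∈ P.piece k,
      (n : ℝ) ^ 2 * |Fn n s| ≤ 1 := by
    intro k hk
    have := Metric.tendstoUniformlyOn_iff.1 (h k hk).2 1 one_pos
    filter_upwards [this, eventually_ge_atTop 1] with n hn hn1 s hs
    have h2 := hn s hs
    rw [dist_zero_left, Real.norm_eq_abs] at h2
    have hkm : (k : ℝ) ≤ P.m := by exact_mod_cast (Finset.mem_Icc.1 hk).2
    have hpow : 1 ≤ (n : ℝ) ^ (2 * ((P.m : ℝ) - (k : ℝ)) + 1 + δ) :=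
      Real.one_le_rpow (by exact_mod_cast hn1) (by linarith)
    have h3 := (le_abs_self _).trans h2.le
    have h4 : 0 ≤ (n : ℝ) ^ 2 * |Fn n s| := by positivity
    have h5 := abs_nonneg (derivWithin (Fn n) (P.piece k) s)
    nlinarith
  filter_upwards [(Finset.eventually_all _).2 h1] with n hn s hs
  obtain ⟨k, hk, hsk⟩ := exists_mem_piece hτ hT hs
  exact hn k hk s hsk

theorem HistoryDecay.eventually_le {P : Params} {δ : ℝ} (hδ : 0 < δ)
    {Φn : ℕ → ℝ → ℝ} (h : HistoryDecay P δ Φn) :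
    ∀ᶠ n : ℕ in atTop, ∀ s ∈ Icc (-P.τ) 0, (n : ℝ) ^ 4 * |Φn n s| ≤ 1 := by
  have := Metric.tendstoUniformlyOn_iff.1 h 1 one_pos
  filter_upwards [this, eventually_ge_atTop 1] with n hn hn1 s hs
  have h2 := hn s hs
  rw [dist_zero_left, Real.norm_eq_abs] at h2
  have hpow : 1 ≤ (n : ℝ) ^ (2 * (P.m : ℝ) + 1 + δ) :=
    Real.one_le_rpow (by exact_mod_cast hn1) (by positivity)
  have h3 := (le_abs_self _).trans h2.le
  have h4 : 0 ≤ (n : ℝ) ^ 4 * |Φn n s| := by positivity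
  have h5 := abs_nonneg (iteratedDerivWithin 2 (Φn n) (Icc (-P.τ) 0) s)
  have h6 : 0 ≤ (n : ℝ) ^ 2 * |derivWithin (Φn n) (Icc (-P.τ) 0) s| := by positivity
  nlinarith

/-- Each of the finitely many exceptional indices is bounded by compactness, and these bounds are
summed into `A`. -/
theorem exists_bound_of_eventually {f : ℕ → ℝ → ℝ} {K : Set ℝ} (hK : IsCompact K) {p : ℕ}
    (hf : ∀ n, 1 ≤ n → ContinuousOn (f n) K)
    (hev : ∀ᶠ n : ℕ in atTop, ∀ s ∈ K, (n : ℝ) ^ p * |f n s| ≤ 1) :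
    ∃ A, 0 ≤ A ∧ ∀ n : ℕ, 1 ≤ n → ∀ s ∈ K, |f n s| ≤ A / (n : ℝ) ^ p := by
  obtain ⟨N, hN⟩ := eventually_atTop.1 hev
  have hC : ∀ n : ℕ, ∃ C, 1 ≤ n → ∀ s ∈ K, |f n s| ≤ C := by
    intro n
    by_cases hn : 1 ≤ n
    · obtain ⟨C, hC⟩ := hK.exists_bound_of_continuousOn (hf n hn)
      exact ⟨C, fun _ => hC⟩
    · exact ⟨0, fun h => absurd h hn⟩
  choose C hC using hC
  have hsum : 0 ≤ ∑ j ∈ Finset.range N, |C j| * (j : ℝ) ^ p :=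
    Finset.sum_nonneg fun j _ => by positivity
  refine ⟨1 + ∑ j ∈ Finset.range N, |C j| * (j : ℝ) ^ p, by positivity, fun n hn s hs => ?_⟩
  have hn0 : (0 : ℝ) < (n : ℝ) ^ p := by
    have : (0 : ℝ) < n := by exact_mod_cast hn
    positivity
  rw [le_div_iff₀ hn0]
  rcases le_or_gt N n with h | h
  · linarith [hN n h s hs]
  · have h1 : |C n| * (n : ℝ) ^ p ≤ ∑ j ∈ Finset.range N, |C j| * (j : ℝ) ^ p :=
      Finset.single_le_sum (f := fun j : ℕ => |C j| * (j : ℝ) ^ p)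
        (fun j _ => by positivity) (Finset.mem_range.2 h)
    have h2 : |f n s| * (n : ℝ) ^ p ≤ |C n| * (n : ℝ) ^ p :=
      mul_le_mul_of_nonneg_right ((hC n hn s hs).trans (le_abs_self _)) hn0.le
    linarith

/-- Along even and odd `n` the sequence is constantly `p - q` and `p + q`. -/
theorem eq_zero_of_tendsto_alternating {p q : ℝ}
    (h : Tendsto (fun n : ℕ => p - (-1) ^ n * q) atTop (𝓝 0)) : p = 0 ∧ q = 0 := by
  have he : Tendsto (fun k : ℕ => 2 * k) atTop atTop :=
    tendsto_atTop_mono (fun k => show k ≤ _ by omega) tendsto_id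
  have ho : Tendsto (fun k : ℕ => 2 * k + 1) atTop atTop :=
    tendsto_atTop_mono (fun k => show k ≤ _ by omega) tendsto_id
  have h1 := h.comp he
  have h2 := h.comp ho
  simp only [Function.comp_def, pow_mul, pow_add, neg_one_sq, one_pow, pow_one, one_mul,
    tendsto_const_nhds_iff] at h1 h2
  constructor <;> linarith

theorem UCoeff_eq_exp_mul (P : Params) (φ : ℝ → ℝ → ℝ) (μ₁ μ₂ Ψ : ℝ → ℝ) (n : ℕ) (t : ℝ) :
    UCoeff P φ μ₁ μ₂ Ψ n t = Real.exp (P.L n * t) * UCoeff P φ μ₁ μ₂ Ψ n 0 := by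
  rw [UCoeff, UCoeff, ← mul_assoc, ← Real.exp_add]
  congr 2
  ring

theorem continuous_UCoeff (P : Params) (φ : ℝ → ℝ → ℝ) (μ₁ μ₂ Ψ : ℝ → ℝ) (n : ℕ) :
    Continuous (UCoeff P φ μ₁ μ₂ Ψ n) := by
  unfold UCoeff; fun_prop

theorem L_eq (P : Params) (n : ℕ) :
    P.L n = P.c₁ - (Real.pi * P.a₁ / P.l) ^ 2 * (n : ℝ) ^ 2 := by
  rw [Params.L]; ring

/-- The decay of the source coefficients forces the boundary defects to vanish. -/
theorem boundaryDefect_eq_zero {P : Params} (hl : 0 < P.l) (hτ : 0 < P.τ) (hT : 0 < P.T)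
    (ha₁ : P.a₁ ≠ 0) {φ : ℝ → ℝ → ℝ} {μ₁ μ₂ Ψ : ℝ → ℝ}
    (hμ₁ : ContinuousOn μ₁ (Icc (-P.τ) P.T)) (hμ₁' : ContDiffOn ℝ 1 μ₁ (Icc 0 P.T))
    (hμ₂ : ContinuousOn μ₂ (Icc (-P.τ) P.T)) (hμ₂' : ContDiffOn ℝ 1 μ₂ (Icc 0 P.T))
    {δ : ℝ} (hδ : 0 < δ) (hFn : SourceDecay P δ (FCoeff P φ μ₁ μ₂ Ψ)) :
    ∀ t ∈ Icc 0 P.T, boundaryDefect P μ₁ t = 0 ∧ boundaryDefect P μ₂ t = 0 := by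
  have hev := hFn.eventually_le hτ hT hδ
  set p := boundaryDefect P μ₁ with hp
  set q := boundaryDefect P μ₂ with hq
  have hpos : ∀ t ∈ Ioc 0 P.T, p t = 0 ∧ q t = 0 := by
    intro t ht
    apply eq_zero_of_tendsto_alternating
    set γ := (Real.pi * P.a₁ / P.l) ^ 2 with hγ
    have hγ0 : 0 < γ := by
      have := Real.pi_ne_zero
      have := hl.ne'
      positivity
    set C : ℝ := 1 + (|p 0| + |q 0|) with hC
    have hC0 : 0 ≤ C := by positivity
    have hbd : ∀ᶠ n : ℕ in atTop, |p t - (-1) ^ n * q t| ≤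
        (Real.pi / 2 * (1 + Real.exp (P.c₁ * t) * C / (γ * t))) / n := by
      filter_upwards [hev, eventually_ge_atTop 1] with n hn hn1
      have hnR : (1 : ℝ) ≤ n := by exact_mod_cast hn1
      have hn0 : (0 : ℝ) < n := by linarith
      have hπ := Real.pi_gt_three
      have hF : ∀ s ∈ Icc 0 P.T, |FCoeff P φ μ₁ μ₂ Ψ n s| ≤ 1 / (n : ℝ) ^ 2 := fun s hs => by
        rw [le_div_iff₀ (by positivity), mul_comm]; exact hn s hs
      -- Boundedness at time 0 is enough: the exponential factor supplies the decay for `t > 0`.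
      have hU0 : |UCoeff P φ μ₁ μ₂ Ψ n 0| ≤ C := by
        have h1 := hF 0 ⟨le_rfl, hT.le⟩
        have h2 : (1 : ℝ) / (n : ℝ) ^ 2 ≤ 1 := by
          rw [div_le_one (by positivity)]; nlinarith
        have h3 : |MCoeff P μ₁ μ₂ n 0| ≤ |p 0| + |q 0| := by
          rw [MCoeff_eq hl _ _ hn1, abs_mul]
          have h4 : |2 / (Real.pi * n)| ≤ 1 := by
            rw [abs_of_pos (by positivity), div_le_one (by positivity)]
            nlinarith
          have h5 : |p 0 - (-1) ^ n * q 0| ≤ |p 0| + |q 0| := by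
            refine (abs_sub _ _).trans ?_
            rw [abs_mul, abs_pow, abs_neg, abs_one, one_pow, one_mul]
          calc _ ≤ 1 * (|p 0| + |q 0|) := mul_le_mul h4 h5 (abs_nonneg _) zero_le_one
            _ = _ := one_mul _
        have h6 : UCoeff P φ μ₁ μ₂ Ψ n 0 = FCoeff P φ μ₁ μ₂ Ψ n 0 - MCoeff P μ₁ μ₂ n 0 := by
          rw [FCoeff]; ring
        rw [h6]
        refine (abs_sub _ _).trans ?_
        linarith
      -- This is `e^{-x} ≤ 1/x` with `x = γ t n²`. It needs `t > 0`, so `t = 0` is reached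
      -- afterwards by continuity.
      have hexp : Real.exp (P.L n * t) ≤ Real.exp (P.c₁ * t) / (γ * t * (n : ℝ) ^ 2) := by
        have hx : 0 < γ * t * (n : ℝ) ^ 2 := by have := ht.1; positivity
        rw [L_eq, show (P.c₁ - γ * (n : ℝ) ^ 2) * t = P.c₁ * t - γ * t * (n : ℝ) ^ 2 by ring,
          Real.exp_sub]
        gcongr
        linarith [Real.add_one_le_exp (γ * t * (n : ℝ) ^ 2)]
      have hU : |UCoeff P φ μ₁ μ₂ Ψ n t| ≤ Real.exp (P.c₁ * t) / (γ * t * (n : ℝ) ^ 2) * C := by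
        rw [UCoeff_eq_exp_mul, abs_mul, abs_of_pos (Real.exp_pos _)]
        have := ht.1
        exact mul_le_mul hexp hU0 (abs_nonneg _) (by positivity)
      have hM : |MCoeff P μ₁ μ₂ n t| ≤
          1 / (n : ℝ) ^ 2 + Real.exp (P.c₁ * t) / (γ * t * (n : ℝ) ^ 2) * C := by
        have h6 : MCoeff P μ₁ μ₂ n t = FCoeff P φ μ₁ μ₂ Ψ n t - UCoeff P φ μ₁ μ₂ Ψ n t := by
          rw [FCoeff]; ring
        rw [h6]
        exact (abs_sub _ _).trans (add_le_add (hF t ⟨ht.1.le, ht.2⟩) hU)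
      rw [MCoeff_eq hl _ _ hn1, abs_mul, abs_of_pos (by positivity)] at hM
      have ht0 := ht.1
      -- Removing the factor `2/(πn)` costs one power of `n` and leaves `O(1/n)`.
      calc |p t - (-1) ^ n * q t|
          = Real.pi * n / 2 * (2 / (Real.pi * n) * |p t - (-1) ^ n * q t|) := by
            field_simp
        _ ≤ Real.pi * n / 2 *
            (1 / (n : ℝ) ^ 2 + Real.exp (P.c₁ * t) / (γ * t * (n : ℝ) ^ 2) * C) := by gcongr
        _ = _ := by field_simp
    exact squeeze_zero_norm' (by simpa only [Real.norm_eq_abs] using hbd)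
      (tendsto_const_div_atTop_nhds_zero_nat _)
  have hzero : ∀ {r : ℝ → ℝ}, ContinuousOn r (Icc 0 P.T) → (∀ t ∈ Ioc 0 P.T, r t = 0) →
      r 0 = 0 := by
    intro r hr h
    have h1 : Tendsto r (𝓝[Ioc 0 P.T] 0) (𝓝 (r 0)) :=
      (hr 0 ⟨le_rfl, hT.le⟩).mono_left (nhdsWithin_mono _ Ioc_subset_Icc_self)
    rw [nhdsWithin_Ioc_eq_nhdsGT hT] at h1
    have h2 : r =ᶠ[𝓝[>] 0] fun _ => 0 := by
      filter_upwards [Ioc_mem_nhdsGT hT] with s hs using h s hs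
    exact tendsto_nhds_unique h1 (tendsto_const_nhds.congr' h2.symm)
  intro t ht
  rcases eq_or_lt_of_le ht.1 with h0 | h0
  · rw [← h0]
    exact ⟨hzero (continuousOn_boundaryDefect hτ hT hμ₁ hμ₁') fun s hs => (hpos s hs).1,
      hzero (continuousOn_boundaryDefect hτ hT hμ₂ hμ₂') fun s hs => (hpos s hs).2⟩
  · exact hpos t ⟨h0, ht.2⟩

/-- The sine coefficients of a function that is continuous on a rectangle depend continuously on
time. -/
theorem continuous_sineCoeff_clamp {l a b : ℝ} (hl : 0 ≤ l) (hab : a ≤ b) {Φ : ℝ → ℝ → ℝ}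
    (hΦ : ContinuousOn (Function.uncurry Φ) (Icc 0 l ×ˢ Icc a b)) (n : ℕ) :
    Continuous fun t => sineCoeff l n (fun ξ => Φ ξ (max a (min b t))) := by
  have hc : Continuous fun p : ℝ × ℝ => Φ (max 0 (min l p.2)) (max a (min b p.1)) :=
    hΦ.comp_continuous (f := fun p : ℝ × ℝ => (max 0 (min l p.2), max a (min b p.1)))
      (by fun_prop) fun p => ⟨⟨le_max_left _ _, max_le hl (min_le_left _ _)⟩,
        ⟨le_max_left _ _, max_le hab (min_le_left _ _)⟩⟩
  have hi : Continuous fun t => ∫ ξ in (0 : ℝ)..l,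
      Φ (max 0 (min l ξ)) (max a (min b t)) * Real.sin (Real.pi * n / l * ξ) := by
    refine intervalIntegral.continuous_parametric_intervalIntegral_of_continuous'
      (f := fun t ξ => Φ (max 0 (min l ξ)) (max a (min b t)) * Real.sin (Real.pi * n / l * ξ))
      ?_ 0 l
    exact hc.mul (by fun_prop)
  have : (fun t => sineCoeff l n (fun ξ => Φ ξ (max a (min b t)))) = fun t => 2 / l *
      ∫ ξ in (0 : ℝ)..l, Φ (max 0 (min l ξ)) (max a (min b t)) *
        Real.sin (Real.pi * n / l * ξ) := by
    ext t
    rw [sineCoeff]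
    congr 1
    refine intervalIntegral.integral_congr fun ξ hξ => ?_
    rw [uIcc_of_le hl] at hξ
    simp only [min_eq_right hξ.2, max_eq_right hξ.1]
  rw [this]
  exact hi.const_mul _

theorem sineCoeff_sub {l : ℝ} (hl : 0 ≤ l) {f g : ℝ → ℝ} (hf : ContinuousOn f (Icc 0 l))
    (hg : ContinuousOn g (Icc 0 l)) (n : ℕ) :
    sineCoeff l n (fun ξ => f ξ - g ξ) = sineCoeff l n f - sineCoeff l n g := by
  have hs : ContinuousOn (fun ξ => Real.sin (Real.pi * n / l * ξ)) (Icc 0 l) := by fun_prop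
  rw [← uIcc_of_le hl] at hf hg hs
  have := intervalIntegral.integral_sub (μ := MeasureTheory.volume)
    (hf.mul hs).intervalIntegrable (hg.mul hs).intervalIntegrable
  simp only [Pi.mul_apply] at this
  simp only [sineCoeff, sub_mul]
  rw [this, mul_sub]

theorem continuous_lift (P : Params) (μ₁ μ₂ : ℝ → ℝ) (t : ℝ) :
    Continuous fun x => lift P μ₁ μ₂ x t := by
  unfold lift; fun_prop

/-! ### Sine series with time dependent coefficients -/

/-- Termwise differentiation on a closed interval. -/
theorem hasDerivWithinAt_tsum_Icc {S : ℝ} (hS : 0 ≤ S) {f f' : ℕ → ℝ → ℝ} {u : ℕ → ℝ}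
    (hu : Summable u) (hf : ∀ n, ∀ t ∈ Icc 0 S, HasDerivWithinAt (f n) (f' n t) (Icc 0 S) t)
    (hf' : ∀ n, ContinuousOn (f' n) (Icc 0 S)) (hb : ∀ n, ∀ t ∈ Icc 0 S, |f' n t| ≤ u n)
    (h0 : Summable fun n => f n 0) {t : ℝ} (ht : t ∈ Icc 0 S) :
    HasDerivWithinAt (fun s => ∑' n, f n s) (∑' n, f' n t) (Icc 0 S) t := by
  have hmem : ∀ s : ℝ, max 0 (min S s) ∈ Icc 0 S := fun s =>
    ⟨le_max_left _ _, max_le hS (min_le_left _ _)⟩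
  have hid : ∀ s ∈ Icc 0 S, max 0 (min S s) = s := fun s hs => by
    rw [min_eq_right hs.2, max_eq_right hs.1]
  have hc : ∀ n, Continuous fun s => f' n (max 0 (min S s)) := fun n =>
    (hf' n).comp_continuous (by fun_prop) hmem
  -- Integrating the clamped derivative extends each `f n` to a function differentiable on the whole
  -- line, where termwise differentiation is available.
  set F : ℕ → ℝ → ℝ := fun n s => f n 0 + ∫ r in (0 : ℝ)..s, f' n (max 0 (min S r)) with hF
  have hFd : ∀ n s, HasDerivAt (F n) (f' n (max 0 (min S s))) s := fun n s =>
    ((hc n).integral_hasStrictDerivAt 0 s).hasDerivAt.const_add _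
  have hFf : ∀ n, ∀ s ∈ Icc 0 S, f n s = F n s := by
    intro n s hs
    have h1 : (∫ r in (0 : ℝ)..s, f' n (max 0 (min S r))) = f n s - f n 0 := by
      refine intervalIntegral.integral_eq_sub_of_hasDerivAt_of_le hs.1 ?_ (fun r hr => ?_)
        ((hc n).intervalIntegrable _ _)
      · exact fun r hr => ((hf n r ⟨hr.1, hr.2.trans hs.2⟩).continuousWithinAt).mono
          (Icc_subset_Icc le_rfl hs.2)
      · have hr' : r ∈ Icc 0 S := ⟨hr.1.le, hr.2.le.trans hs.2⟩
        rw [hid r hr']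
        exact (hf n r hr').hasDerivAt (Icc_mem_nhds hr.1 (hr.2.trans_le hs.2))
    simp [hF, h1]
  have hF0 : Summable fun n => F n 0 := by simpa [hF] using h0
  have hd := hasDerivAt_tsum hu hFd (fun n s => by
    rw [Real.norm_eq_abs]; exact hb n _ (hmem s)) hF0 t
  rw [hid t ht] at hd
  exact hd.hasDerivWithinAt.congr (fun s hs => tsum_congr fun n => hFf n s hs)
    (tsum_congr fun n => hFf n t ht)

/-- The sine series with coefficients `w n t`, `n ≥ 1`. -/
noncomputable def sineSeries (l : ℝ) (w : ℕ → ℝ → ℝ) (x t : ℝ) : ℝ :=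
  ∑' n : ℕ, w (n + 1) t * Real.sin (Real.pi * ((n + 1 : ℕ) : ℝ) / l * x)

/-- The termwise space derivative of `sineSeries`. -/
noncomputable def cosSeries (l : ℝ) (w : ℕ → ℝ → ℝ) (x t : ℝ) : ℝ :=
  ∑' n : ℕ, w (n + 1) t * (Real.pi * ((n + 1 : ℕ) : ℝ) / l *
    Real.cos (Real.pi * ((n + 1 : ℕ) : ℝ) / l * x))

theorem summable_div_sq (C : ℝ) : Summable fun n : ℕ => C / ((n + 1 : ℕ) : ℝ) ^ 2 := by
  have h := (Real.summable_one_div_nat_pow (p := 2)).2 (by norm_num)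
  have := ((summable_nat_add_iff 1).2 h).mul_left C
  simpa [div_eq_mul_inv] using this

theorem abs_mul_sin_le {a b : ℝ} (h : |a| ≤ b) (θ : ℝ) : |a * Real.sin θ| ≤ b := by
  rw [abs_mul]
  exact (mul_le_of_le_one_right (abs_nonneg _) (Real.abs_sin_le_one _)).trans h

section

variable {l : ℝ} {w : ℕ → ℝ → ℝ} {C : ℝ}

theorem summable_sineSeries {t : ℝ} (hw : ∀ n : ℕ, 1 ≤ n → |w n t| ≤ C / (n : ℝ) ^ 2) (x : ℝ) :
    Summable fun n : ℕ => w (n + 1) t * Real.sin (Real.pi * ((n + 1 : ℕ) : ℝ) / l * x) :=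
  (summable_div_sq C).of_norm_bounded fun n => abs_mul_sin_le (hw (n + 1) (by omega)) _

theorem continuousOn_sineSeries {K : Set ℝ} (s : Set ℝ)
    (hc : ∀ n : ℕ, 1 ≤ n → ContinuousOn (w n) K)
    (hw : ∀ n : ℕ, 1 ≤ n → ∀ t ∈ K, |w n t| ≤ C / (n : ℝ) ^ 2) :
    ContinuousOn (Function.uncurry (sineSeries l w)) (s ×ˢ K) := by
  refine continuousOn_tsum (f := fun (n : ℕ) (p : ℝ × ℝ) =>
    w (n + 1) p.2 * Real.sin (Real.pi * ((n + 1 : ℕ) : ℝ) / l * p.1)) (fun n => ?_)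
    (summable_div_sq C) fun n p hp => abs_mul_sin_le (hw (n + 1) (by omega) _ hp.2) _
  exact ((hc (n + 1) (by omega)).comp continuousOn_snd fun p hp => hp.2).mul (by fun_prop)

theorem le_div_sq_of_le_div_pow_four (hC : 0 ≤ C) {a : ℝ} {n : ℕ} (hn : 1 ≤ n)
    (h : a ≤ C / (n : ℝ) ^ 4) : a ≤ C / (n : ℝ) ^ 2 := by
  refine h.trans (div_le_div_of_nonneg_left hC (by positivity) ?_)
  exact pow_le_pow_right₀ (by exact_mod_cast hn) (by norm_num)

theorem abs_frequency_sq_mul_le {a : ℝ} {n : ℕ} (hn : 1 ≤ n) (h : |a| ≤ C / (n : ℝ) ^ 4) :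
    |-(Real.pi * n / l) ^ 2 * a| ≤ ((Real.pi / l) ^ 2 * C) / (n : ℝ) ^ 2 := by
  have hn0 : (n : ℝ) ≠ 0 := by positivity
  rw [abs_mul, abs_neg, abs_of_nonneg (sq_nonneg _)]
  calc (Real.pi * n / l) ^ 2 * |a| ≤ (Real.pi * n / l) ^ 2 * (C / (n : ℝ) ^ 4) := by gcongr
    _ = _ := by field_simp

theorem abs_frequency_mul_cos_le (hl : 0 < l) (hC : 0 ≤ C) {a : ℝ} {n : ℕ} (hn : 1 ≤ n)
    (h : |a| ≤ C / (n : ℝ) ^ 4) (θ : ℝ) :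
    |a * (Real.pi * n / l * Real.cos θ)| ≤ (Real.pi / l * C) / (n : ℝ) ^ 2 := by
  have hn' : (1 : ℝ) ≤ n := by exact_mod_cast hn
  have hπ := Real.pi_pos
  have hn0 : (0 : ℝ) < n := by linarith
  rw [abs_mul, abs_mul, abs_of_pos (by positivity : 0 < Real.pi * n / l)]
  calc |a| * (Real.pi * n / l * |Real.cos θ|)
      ≤ C / (n : ℝ) ^ 4 * (Real.pi * n / l * 1) := by
        gcongr
        exact Real.abs_cos_le_one _
    _ = (Real.pi / l * C) / (n : ℝ) ^ 3 := by field_simp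
    _ ≤ (Real.pi / l * C) / (n : ℝ) ^ 2 := by
        refine div_le_div_of_nonneg_left (by positivity) (by positivity) ?_
        exact pow_le_pow_right₀ hn' (by norm_num)

theorem hasDerivAt_sineSeries (hl : 0 < l) (hC : 0 ≤ C) {t : ℝ}
    (hw : ∀ n : ℕ, 1 ≤ n → |w n t| ≤ C / (n : ℝ) ^ 4) (x : ℝ) :
    HasDerivAt (fun y => sineSeries l w y t) (cosSeries l w x t) x := by
  refine hasDerivAt_tsum (u := fun n : ℕ => (Real.pi / l * C) / ((n + 1 : ℕ) : ℝ) ^ 2) (y₀ := 0)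
    (g := fun (n : ℕ) y => w (n + 1) t * Real.sin (Real.pi * ((n + 1 : ℕ) : ℝ) / l * y))
    (g' := fun (n : ℕ) y => w (n + 1) t * (Real.pi * ((n + 1 : ℕ) : ℝ) / l *
      Real.cos (Real.pi * ((n + 1 : ℕ) : ℝ) / l * y)))
    (summable_div_sq _) (fun n y => ?_) (fun n y => ?_) (by simp) x
  · have d := ((hasDerivAt_id y).const_mul (Real.pi * ((n + 1 : ℕ) : ℝ) / l)).sin.const_mul
      (w (n + 1) t)
    refine d.congr_deriv ?_
    simp only [id]
    ring
  · exact abs_frequency_mul_cos_le hl hC (by omega) (hw (n + 1) (by omega)) _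

/-- Two space derivatives cost `n²`, so coefficients of order `n⁻⁴` leave the summable majorant
`n⁻²`. -/
theorem hasDerivAt_cosSeries (hl : 0 < l) (hC : 0 ≤ C) {t : ℝ}
    (hw : ∀ n : ℕ, 1 ≤ n → |w n t| ≤ C / (n : ℝ) ^ 4) (x : ℝ) :
    HasDerivAt (fun y => cosSeries l w y t)
      (sineSeries l (fun n t => -(Real.pi * n / l) ^ 2 * w n t) x t) x := by
  have hb : ∀ n : ℕ, |-(Real.pi * ((n + 1 : ℕ) : ℝ) / l) ^ 2 * w (n + 1) t| ≤
      ((Real.pi / l) ^ 2 * C) / ((n + 1 : ℕ) : ℝ) ^ 2 := fun n =>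
    abs_frequency_sq_mul_le (by omega) (hw (n + 1) (by omega))
  refine hasDerivAt_tsum
    (u := fun n : ℕ => ((Real.pi / l) ^ 2 * C) / ((n + 1 : ℕ) : ℝ) ^ 2)
    (y₀ := x)
    (g := fun (n : ℕ) y => w (n + 1) t * (Real.pi * ((n + 1 : ℕ) : ℝ) / l *
      Real.cos (Real.pi * ((n + 1 : ℕ) : ℝ) / l * y)))
    (g' := fun (n : ℕ) y => -(Real.pi * ((n + 1 : ℕ) : ℝ) / l) ^ 2 * w (n + 1) t *
      Real.sin (Real.pi * ((n + 1 : ℕ) : ℝ) / l * y))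
    (summable_div_sq _) (fun n y => ?_) (fun n y => abs_mul_sin_le (hb n) _) ?_ x
  · have d := (((hasDerivAt_id y).const_mul (Real.pi * ((n + 1 : ℕ) : ℝ) / l)).cos.const_mul
      (Real.pi * ((n + 1 : ℕ) : ℝ) / l)).const_mul (w (n + 1) t)
    refine d.congr_deriv ?_
    simp only [id]
    ring
  · exact (summable_div_sq (Real.pi / l * C)).of_norm_bounded fun n =>
      abs_frequency_mul_cos_le hl hC (by omega) (hw (n + 1) (by omega)) _

theorem hasDerivWithinAt_sineSeries {w' : ℕ → ℝ → ℝ} {S : ℝ} (hS : 0 ≤ S)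
    (hd : ∀ n : ℕ, 1 ≤ n → ∀ t ∈ Icc 0 S, HasDerivWithinAt (w n) (w' n t) (Icc 0 S) t)
    (hc : ∀ n : ℕ, 1 ≤ n → ContinuousOn (w' n) (Icc 0 S))
    (hw : ∀ n : ℕ, 1 ≤ n → |w n 0| ≤ C / (n : ℝ) ^ 2) {C' : ℝ}
    (hw' : ∀ n : ℕ, 1 ≤ n → ∀ t ∈ Icc 0 S, |w' n t| ≤ C' / (n : ℝ) ^ 2) (x : ℝ) {t : ℝ}
    (ht : t ∈ Icc 0 S) :
    HasDerivWithinAt (fun s => sineSeries l w x s) (sineSeries l w' x t) (Icc 0 S) t :=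
  hasDerivWithinAt_tsum_Icc hS (summable_div_sq C')
    (f := fun n s => w (n + 1) s * Real.sin (Real.pi * ((n + 1 : ℕ) : ℝ) / l * x))
    (f' := fun n s => w' (n + 1) s * Real.sin (Real.pi * ((n + 1 : ℕ) : ℝ) / l * x))
    (fun n s hs => (hd (n + 1) (by omega) s hs).mul_const _)
    (fun n => (hc (n + 1) (by omega)).mul_const _)
    (fun n s hs => abs_mul_sin_le (hw' (n + 1) (by omega) s hs) _)
    (summable_sineSeries hw x) ht

end

/-! ### The solution -/

/-- `c₂ - (π n a₂ / l)²`, the coefficient of the delayed term in the equation of the `n`-th mode. -/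
noncomputable def Params.B (P : Params) (n : ℕ) : ℝ :=
  P.c₂ - (Real.pi * n / P.l * P.a₂) ^ 2

theorem D_eq (P : Params) (n : ℕ) : P.D n = P.B n * Real.exp (-(P.L n) * P.τ) := rfl

theorem L_le (P : Params) (n : ℕ) :
    P.L n ≤ |P.c₁| - (Real.pi * P.a₁ / P.l) ^ 2 * (n : ℝ) ^ 2 := by
  rw [L_eq]; linarith [le_abs_self P.c₁]

theorem abs_L_le (P : Params) {n : ℕ} (hn : 1 ≤ n) :
    |P.L n| ≤ (|P.c₁| + (Real.pi * P.a₁ / P.l) ^ 2) * (n : ℝ) ^ 2 := by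
  have hn' : (1 : ℝ) ≤ (n : ℝ) ^ 2 := one_le_pow₀ (by exact_mod_cast hn)
  rw [L_eq]
  refine (abs_sub _ _).trans ?_
  rw [abs_of_nonneg (by positivity : 0 ≤ (Real.pi * P.a₁ / P.l) ^ 2 * (n : ℝ) ^ 2)]
  nlinarith [abs_nonneg P.c₁]

theorem abs_B_le (P : Params) {n : ℕ} (hn : 1 ≤ n) :
    |P.B n| ≤ (|P.c₂| + (Real.pi * P.a₂ / P.l) ^ 2) * (n : ℝ) ^ 2 := by
  have hn' : (1 : ℝ) ≤ (n : ℝ) ^ 2 := one_le_pow₀ (by exact_mod_cast hn)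
  rw [Params.B, show (Real.pi * n / P.l * P.a₂) ^ 2 = (Real.pi * P.a₂ / P.l) ^ 2 * (n : ℝ) ^ 2 by
    ring]
  refine (abs_sub _ _).trans ?_
  rw [abs_of_nonneg (by positivity : 0 ≤ (Real.pi * P.a₂ / P.l) ^ 2 * (n : ℝ) ^ 2)]
  nlinarith [abs_nonneg P.c₂]

/-- The `n`-th mode of the solution, reduced to homogeneous boundary values. -/
noncomputable def modeCoeff (P : Params) (φ : ℝ → ℝ → ℝ) (μ₁ μ₂ Ψ : ℝ → ℝ) (n : ℕ) : ℝ → ℝ :=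
  delayIter (P.L n) (P.B n) P.τ (fun t => PhiCoeff P φ μ₁ μ₂ n (max (-P.τ) (min 0 t)))
    (UCoeff P φ μ₁ μ₂ Ψ n) (P.m + 1)

/-- The time derivative of the `n`-th mode on `[0, T]`. -/
noncomputable def modeDeriv (P : Params) (φ : ℝ → ℝ → ℝ) (μ₁ μ₂ Ψ : ℝ → ℝ) (n : ℕ) (t : ℝ) : ℝ :=
  P.L n * modeCoeff P φ μ₁ μ₂ Ψ n t + P.B n * modeCoeff P φ μ₁ μ₂ Ψ n (t - P.τ)
    + UCoeff P φ μ₁ μ₂ Ψ n t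

theorem historyTerm_congr {P : Params} (hτ : 0 < P.τ) {n : ℕ} {h h' : ℝ → ℝ}
    (hh : ∀ s ∈ Icc (-P.τ) 0, h s = h' s) (t : ℝ) : historyTerm P n h t = historyTerm P n h' t := by
  rw [historyTerm, historyTerm, hh 0 ⟨by linarith, le_rfl⟩]
  congr 2
  refine intervalIntegral.integral_congr fun s hs => ?_
  rw [uIcc_of_le (by linarith)] at hs
  simp only [hh s hs]

theorem historyTerm_sub {P : Params} (hτ : 0 < P.τ) {n : ℕ} {h h' : ℝ → ℝ}
    (hh : ContinuousOn h (Icc (-P.τ) 0)) (hh' : ContinuousOn h' (Icc (-P.τ) 0)) (t : ℝ) :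
    historyTerm P n (fun s => h s - h' s) t = historyTerm P n h t - historyTerm P n h' t := by
  have hE : IntervalIntegrable (fun s => Real.exp (P.L n * (t - s)) *
      delayedExp P.τ (P.D n) (t - 2 * P.τ - s)) MeasureTheory.volume (-P.τ) 0 := by
    have h1 := (intervalIntegrable_mul_delayedExp (b := P.D n) hτ
      (by fun_prop : Continuous fun r => Real.exp (P.L n * r)) (2 * P.τ) (t - -P.τ)
      (t - 0)).comp_sub_left t
    simp only [sub_sub_cancel] at h1
    convert h1 using 4
    ring
  rw [← uIcc_of_le (by linarith)] at hh hh'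
  have hi := intervalIntegral.integral_sub (hE.mul_continuousOn hh) (hE.mul_continuousOn hh')
  simp only [mul_sub] at hi
  simp only [historyTerm, mul_sub]
  rw [hi]
  ring

section

variable {P : Params} {φ : ℝ → ℝ → ℝ} {μ₁ μ₂ Ψ : ℝ → ℝ}

theorem continuous_modeCoeff (hl : 0 < P.l) (hτ : 0 < P.τ)
    (hΦ : ContinuousOn (Function.uncurry (Phi P φ μ₁ μ₂)) (Icc 0 P.l ×ˢ Icc (-P.τ) 0)) (n : ℕ) :
    Continuous (modeCoeff P φ μ₁ μ₂ Ψ n) :=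
  continuous_delayIter (continuous_sineCoeff_clamp hl.le (by linarith) hΦ n)
    (continuous_UCoeff P φ μ₁ μ₂ Ψ n) _

theorem continuous_modeDeriv (h : ∀ n, Continuous (modeCoeff P φ μ₁ μ₂ Ψ n)) (n : ℕ) :
    Continuous (modeDeriv P φ μ₁ μ₂ Ψ n) :=
  (((h n).const_mul _).add (((h n).comp (continuous_sub_right P.τ)).const_mul _)).add
    (continuous_UCoeff P φ μ₁ μ₂ Ψ n)

theorem modeCoeff_of_mem {t : ℝ} (ht : t ∈ Icc (-P.τ) 0) (n : ℕ) :
    modeCoeff P φ μ₁ μ₂ Ψ n t = PhiCoeff P φ μ₁ μ₂ n t := by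
  rw [modeCoeff, delayIter_of_nonpos _ ht.2, min_eq_right ht.2, max_eq_right ht.1]

/-- The iterate `m + 1` solves its equation while `t - τ ≤ mτ`, and `T ≤ mτ`. The source is `U_n`
alone, which is the full reduced source once the defects vanish. -/
theorem hasDerivWithinAt_modeCoeff (hl : 0 < P.l) (hτ : 0 < P.τ)
    (hΦ : ContinuousOn (Function.uncurry (Phi P φ μ₁ μ₂)) (Icc 0 P.l ×ˢ Icc (-P.τ) 0)) (n : ℕ)
    {t : ℝ} (ht : t ∈ Icc 0 P.T) :
    HasDerivWithinAt (modeCoeff P φ μ₁ μ₂ Ψ n) (modeDeriv P φ μ₁ μ₂ Ψ n t) (Icc 0 P.T) t :=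
  hasDerivWithinAt_delayIter (continuous_sineCoeff_clamp hl.le (by linarith) hΦ n)
    (continuous_UCoeff P φ μ₁ μ₂ Ψ n) P.m ht (by linarith [ht.2, le_m_mul (P := P) hτ])

theorem continuousOn_Phi_slice
    (hΦ : ContinuousOn (Function.uncurry (Phi P φ μ₁ μ₂)) (Icc 0 P.l ×ˢ Icc (-P.τ) 0)) {t : ℝ}
    (ht : t ∈ Icc (-P.τ) 0) : ContinuousOn (fun x => Phi P φ μ₁ μ₂ x t) (Icc 0 P.l) :=
  hΦ.comp (f := fun x => (x, t)) (by fun_prop) fun _ hx => ⟨hx, ht⟩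

theorem PhiCoeff_eq_sub (hl : 0 < P.l)
    (hΦ : ContinuousOn (Function.uncurry (Phi P φ μ₁ μ₂)) (Icc 0 P.l ×ˢ Icc (-P.τ) 0)) (n : ℕ)
    {t : ℝ} (ht : t ∈ Icc (-P.τ) 0) :
    PhiCoeff P φ μ₁ μ₂ n t = sineCoeff P.l n (fun ξ => φ ξ t) - mCoeff P μ₁ μ₂ n t := by
  have hlift := (continuous_lift P μ₁ μ₂ t).continuousOn (s := Icc 0 P.l)
  refine sineCoeff_sub hl.le (f := fun ξ => φ ξ t) ?_ hlift n
  -- Continuity of `φ` in `x` is recovered from that of `Φ` and the affine part.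
  refine ((continuousOn_Phi_slice hΦ ht).add hlift).congr fun x _ => ?_
  simp [Phi]

/-- At the final time the modes attain the coefficients of the target. -/
theorem modeCoeff_final (hl : 0 < P.l) (hτ : 0 < P.τ) (hT : 0 < P.T)
    (hμ₁ : ContinuousOn μ₁ (Icc (-P.τ) P.T)) (hμ₂ : ContinuousOn μ₂ (Icc (-P.τ) P.T))
    (hΦ : ContinuousOn (Function.uncurry (Phi P φ μ₁ μ₂)) (Icc 0 P.l ×ˢ Icc (-P.τ) 0))
    (hdef : ∀ t ∈ Icc 0 P.T, boundaryDefect P μ₁ t = 0 ∧ boundaryDefect P μ₂ t = 0)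
    {n : ℕ} (hn : 1 ≤ n) (hden : delayedExp P.τ (P.D n) P.T ≠ 1) :
    modeCoeff P φ μ₁ μ₂ Ψ n P.T = sineCoeff P.l n Ψ - mCoeff P μ₁ μ₂ n P.T := by
  have hsub : Icc (-P.τ) 0 ⊆ Icc (-P.τ) P.T := Icc_subset_Icc le_rfl hT.le
  have hrep := delay_representation (L := P.L n) (B := P.B n) (D := P.D n) hτ hT.le (D_eq P n)
    (continuous_modeCoeff (Ψ := Ψ) hl hτ hΦ n) (continuous_UCoeff P φ μ₁ μ₂ Ψ n)
    (fun t ht => (hasDerivWithinAt_modeCoeff hl hτ hΦ n ⟨ht.1.le, ht.2.le⟩).hasDerivAt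
      (Icc_mem_nhds ht.1 ht.2))
  have hm : ContinuousOn (mCoeff P μ₁ μ₂ n) (Icc (-P.τ) 0) := by
    have : ContinuousOn (fun t => 2 / (Real.pi * n) * (μ₁ t - (-1) ^ n * μ₂ t)) (Icc (-P.τ) 0) :=
      ((hμ₁.mono hsub).sub ((hμ₂.mono hsub).const_mul _)).const_mul _
    exact this.congr fun t _ => mCoeff_eq hl _ _ hn t
  have hPhi : ContinuousOn (PhiCoeff P φ μ₁ μ₂ n) (Icc (-P.τ) 0) :=
    (continuous_modeCoeff (Ψ := Ψ) hl hτ hΦ n).continuousOn.congr fun t ht =>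
      (modeCoeff_of_mem ht n).symm
  have hφc : ContinuousOn (fun s => sineCoeff P.l n (fun ξ => φ ξ s)) (Icc (-P.τ) 0) :=
    (hPhi.add hm).congr fun t ht => by
      simp only [Pi.add_apply]
      rw [PhiCoeff_eq_sub hl hΦ n ht]; ring
  have hhist : historyTerm P n (modeCoeff P φ μ₁ μ₂ Ψ n) P.T =
      s₁ P φ n P.T - historyTerm P n (mCoeff P μ₁ μ₂ n) P.T := by
    rw [s₁, ← historyTerm_sub hτ hφc hm]
    exact historyTerm_congr hτ (fun s hs => by
      rw [modeCoeff_of_mem hs, PhiCoeff_eq_sub hl hΦ n hs]) _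
  have hM : (∫ s in (0 : ℝ)..P.T, Real.exp (P.L n * (P.T - s)) *
      delayedExp P.τ (P.D n) (P.T - P.τ - s) * MCoeff P μ₁ μ₂ n s) = 0 := by
    rw [intervalIntegral.integral_congr (g := fun _ => (0 : ℝ))]
    · simp
    · intro s hs
      rw [uIcc_of_le hT.le] at hs
      simp [MCoeff_eq hl _ _ hn, hdef s hs]
  have hs₂ : s₂ P μ₁ μ₂ n P.T = -historyTerm P n (mCoeff P μ₁ μ₂ n) P.T := by
    rw [s₂, hM, add_zero]
  -- The exponential in `U_n` is inverse to that of the kernel. What remains is `R_n D_n /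
  -- (exp_τ(D_n, T) - 1)` times the integral of the delayed exponential, that is, `R_n`.
  have hU : (∫ s in (0 : ℝ)..P.T, Real.exp (P.L n * (P.T - s)) *
      delayedExp P.τ (P.D n) (P.T - P.τ - s) * UCoeff P φ μ₁ μ₂ Ψ n s) =
      R P φ μ₁ μ₂ Ψ n := by
    have h1 : ∀ s, Real.exp (P.L n * (P.T - s)) * delayedExp P.τ (P.D n) (P.T - P.τ - s) *
        UCoeff P φ μ₁ μ₂ Ψ n s =
        (R P φ μ₁ μ₂ Ψ n * P.D n / (delayedExp P.τ (P.D n) P.T - 1)) *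
          delayedExp P.τ (P.D n) (P.T - P.τ - s) := by
      intro s
      have h2 : Real.exp (P.L n * (P.T - s)) * Real.exp (-(P.L n) * (P.T - s)) = 1 := by
        rw [← Real.exp_add]; simp
      rw [UCoeff]
      linear_combination ((R P φ μ₁ μ₂ Ψ n * P.D n / (delayedExp P.τ (P.D n) P.T - 1)) *
          delayedExp P.τ (P.D n) (P.T - P.τ - s)) * h2
    simp only [h1]
    rw [intervalIntegral.integral_const_mul]
    have h3 := mul_integral_delayedExp (b := P.D n) hτ hT.le
    have h4 : delayedExp P.τ (P.D n) P.T - 1 ≠ 0 := sub_ne_zero.2 hden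
    rw [div_mul_eq_mul_div, mul_assoc, h3, mul_div_assoc, div_self h4, mul_one]
  rw [hU] at hrep
  have : modeCoeff P φ μ₁ μ₂ Ψ n P.T =
      historyTerm P n (modeCoeff P φ μ₁ μ₂ Ψ n) P.T + R P φ μ₁ μ₂ Ψ n := hrep
  rw [this, hhist, R, hs₂]
  ring

theorem sineSeries_at_ends {l : ℝ} (hl : 0 < l) (w : ℕ → ℝ → ℝ) (t : ℝ) :
    sineSeries l w 0 t = 0 ∧ sineSeries l w l t = 0 := by
  constructor
  · simp [sineSeries]
  · rw [sineSeries, ← tsum_zero (β := ℕ)]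
    refine tsum_congr fun n => ?_
    rw [div_mul_cancel₀ _ hl.ne', mul_comm Real.pi, Real.sin_nat_mul_pi, mul_zero]

theorem lift_at_ends (hl : 0 < P.l) (t : ℝ) :
    lift P μ₁ μ₂ 0 t = μ₁ t ∧ lift P μ₁ μ₂ P.l t = μ₂ t := by
  constructor
  · simp [lift]
  · rw [lift, div_self hl.ne']; ring

end

end DelayHeat

/-! ### Assembly of the solution -/

open DelayHeat in
theorem mainTheorem1 (P : DelayHeat.Params) (hl : 0 < P.l) (hτ : 0 < P.τ) (hT : 0 < P.T)
    (ha₁ : P.a₁ ≠ 0) (ha₂ : P.a₂ ≠ 0)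
    (φ : ℝ → ℝ → ℝ) (μ₁ μ₂ Ψ : ℝ → ℝ)
    -- regularity of the data
    (hμ₁ : ContinuousOn μ₁ (Set.Icc (-P.τ) P.T)) (hμ₁' : ContDiffOn ℝ 1 μ₁ (Set.Icc 0 P.T))
    (hμ₂ : ContinuousOn μ₂ (Set.Icc (-P.τ) P.T)) (hμ₂' : ContDiffOn ℝ 1 μ₂ (Set.Icc 0 P.T))
    (hΨ : ContinuousOn Ψ (Set.Icc 0 P.l))
    (hΦ : DelayHeat.TimeC2 P (DelayHeat.Phi P φ μ₁ μ₂))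
    -- compatibility of the data
    (hφ : ∀ t ∈ Set.Icc (-P.τ) 0, φ 0 t = μ₁ t ∧ φ P.l t = μ₂ t)
    (hΨ₀ : Ψ 0 = μ₁ P.T) (hΨl : Ψ P.l = μ₂ P.T)
    -- the denominators in the definition of the control do not vanish
    (hden : ∀ n : ℕ, 1 ≤ n → DelayHeat.delayedExp P.τ (P.D n) P.T ≠ 1)
    -- decay of the Fourier coefficients
    (δ : ℝ) (hδ : 0 < δ)
    (hΦn : DelayHeat.HistoryDecay P δ (DelayHeat.PhiCoeff P φ μ₁ μ₂))
    (hFn : DelayHeat.SourceDecay P δ (DelayHeat.FCoeff P φ μ₁ μ₂ Ψ)) :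
    (∀ x ∈ Set.Icc 0 P.l, ∀ t ∈ Set.Icc 0 P.T,
      Summable (fun n : ℕ => DelayHeat.UCoeff P φ μ₁ μ₂ Ψ (n + 1) t *
        Real.sin (Real.pi * ((n + 1 : ℕ) : ℝ) / P.l * x))) ∧
    ContinuousOn (Function.uncurry (DelayHeat.control P φ μ₁ μ₂ Ψ))
      (Set.Icc 0 P.l ×ˢ Set.Icc 0 P.T) ∧
    ∃ u : ℝ → ℝ → ℝ,
      DelayHeat.IsClassicalSolution P (DelayHeat.control P φ μ₁ μ₂ Ψ) φ μ₁ μ₂ u ∧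
      (∀ v : ℝ → ℝ → ℝ,
        DelayHeat.IsClassicalSolution P (DelayHeat.control P φ μ₁ μ₂ Ψ) φ μ₁ μ₂ v →
        ∀ x ∈ Set.Icc 0 P.l, ∀ t ∈ Set.Icc (-P.τ) P.T, v x t = u x t) ∧
      ∀ x ∈ Set.Icc 0 P.l, u x P.T = Ψ x := by
  obtain ⟨-, -, -, hΦc, -, -⟩ := hΦ
  have hdef := boundaryDefect_eq_zero hl hτ hT ha₁ hμ₁ hμ₁' hμ₂ hμ₂' hδ hFn
  -- decay of the coefficients
  obtain ⟨F, hF0, hF⟩ : ∃ F, 0 ≤ F ∧ ∀ n : ℕ, 1 ≤ n → ∀ s ∈ Icc 0 P.T,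
      |UCoeff P φ μ₁ μ₂ Ψ n s| ≤ F / (n : ℝ) ^ 2 := by
    refine exists_bound_of_eventually isCompact_Icc
      (fun n _ => (continuous_UCoeff P φ μ₁ μ₂ Ψ n).continuousOn) ?_
    filter_upwards [hFn.eventually_le hτ hT hδ, eventually_ge_atTop 1] with n hn hn1 s hs
    -- With vanishing defects `M_n = 0`, so the bound on `F_n` is a bound on `U_n`.
    have := hn s hs
    rwa [FCoeff, MCoeff_eq hl _ _ hn1, (hdef s hs).1, (hdef s hs).2, mul_zero, sub_zero, mul_zero,
      add_zero] at this
  have hcont : ∀ n, Continuous (modeCoeff P φ μ₁ μ₂ Ψ n) := continuous_modeCoeff hl hτ hΦc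
  obtain ⟨A, hA0, hA⟩ : ∃ A, 0 ≤ A ∧ ∀ n : ℕ, 1 ≤ n → ∀ s ∈ Icc (-P.τ) 0,
      |PhiCoeff P φ μ₁ μ₂ n s| ≤ A / (n : ℝ) ^ 4 :=
    exists_bound_of_eventually isCompact_Icc (fun n _ => (hcont n).continuousOn.congr
      fun t ht => (modeCoeff_of_mem ht n).symm) (hΦn.eventually_le hδ)
  obtain ⟨C, hC0, hC⟩ : ∃ C, 0 ≤ C ∧ ∀ n : ℕ, 1 ≤ n → ∀ t ≤ P.T,
      |modeCoeff P φ μ₁ μ₂ Ψ n t| ≤ C / (n : ℝ) ^ 4 := by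
    have hγ : 0 < (Real.pi * P.a₁ / P.l) ^ 2 := by
      have := Real.pi_ne_zero
      have := hl.ne'
      positivity
    obtain ⟨C, hC0, hC⟩ := exists_abs_delayIter_le (T := P.T) hγ (abs_nonneg P.c₁)
      (by positivity : 0 ≤ |P.c₂| + (Real.pi * P.a₂ / P.l) ^ 2) hA0 hF0 hτ (P.m + 1)
    refine ⟨C, hC0, fun n hn t ht => ?_⟩
    have hn0 : (0 : ℝ) < n := by exact_mod_cast hn
    have h4 : (n : ℝ) ^ 4 = ((n : ℝ) ^ 2) ^ 2 := by ring
    rw [h4]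
    -- The parameter `ν` of the mode estimate is `n²`.
    refine hC _ _ _ _ _ (by positivity) (continuous_sineCoeff_clamp hl.le (by linarith) hΦc n)
      (continuous_UCoeff P φ μ₁ μ₂ Ψ n) (L_le P n) (abs_B_le P hn) (fun s => ?_) (hF n hn) t ht
    rw [← h4]
    exact hA n hn _ ⟨le_max_left _ _, max_le (by linarith) (min_le_left _ _)⟩
  have hC2 : ∀ n : ℕ, 1 ≤ n → ∀ t ≤ P.T, |modeCoeff P φ μ₁ μ₂ Ψ n t| ≤ C / (n : ℝ) ^ 2 :=
    fun n hn t ht => le_div_sq_of_le_div_pow_four hC0 hn (hC n hn t ht)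
  obtain ⟨C', hC'⟩ : ∃ C', ∀ n : ℕ, 1 ≤ n → ∀ t ∈ Icc 0 P.T,
      |modeDeriv P φ μ₁ μ₂ Ψ n t| ≤ C' / (n : ℝ) ^ 2 := by
    refine ⟨(|P.c₁| + (Real.pi * P.a₁ / P.l) ^ 2) * C + (|P.c₂| + (Real.pi * P.a₂ / P.l) ^ 2) * C
      + F, fun n hn t ht => ?_⟩
    have hn0 : (0 : ℝ) < n := by exact_mod_cast hn
    refine (abs_add_le _ _).trans ((add_le_add (abs_add_le _ _) (hF n hn t ht)).trans ?_)
    rw [abs_mul, abs_mul]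
    have h1 := mul_le_mul (abs_L_le P hn) (hC n hn t ht.2) (abs_nonneg _) (by positivity)
    have h2 := mul_le_mul (abs_B_le P hn) (hC n hn (t - P.τ) (by linarith [ht.2])) (abs_nonneg _)
      (by positivity)
    refine (add_le_add (add_le_add h1 h2) le_rfl).trans (le_of_eq ?_)
    field_simp
  set κ : ℕ → ℝ → ℝ := fun n t => -(Real.pi * n / P.l) ^ 2 * modeCoeff P φ μ₁ μ₂ Ψ n t with hκ
  have hκb : ∀ n : ℕ, 1 ≤ n → ∀ t ≤ P.T,
      |κ n t| ≤ ((Real.pi / P.l) ^ 2 * C) / (n : ℝ) ^ 2 :=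
    fun n hn t ht => abs_frequency_sq_mul_le hn (hC n hn t ht)
  have hτT : Icc 0 P.T ⊆ Icc (-P.τ) P.T := Icc_subset_Icc (by linarith) le_rfl
  have hu : IsClassicalSolution P (control P φ μ₁ μ₂ Ψ) φ μ₁ μ₂
      (fun x t => lift P μ₁ μ₂ x t + sineSeries P.l (modeCoeff P φ μ₁ μ₂ Ψ) x t) := by
    refine ⟨fun x t => lift P (derivWithin μ₁ (Icc 0 P.T)) (derivWithin μ₂ (Icc 0 P.T)) x t
        + sineSeries P.l (modeDeriv P φ μ₁ μ₂ Ψ) x t,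
      fun x t => 1 / P.l * (μ₂ t - μ₁ t) + cosSeries P.l (modeCoeff P φ μ₁ μ₂ Ψ) x t,
      fun x t => sineSeries P.l κ x t, ?_, ?_, ?_, ?_, ?_, ?_, ?_, ?_⟩
    · have h1 : ContinuousOn (Function.uncurry (lift P μ₁ μ₂)) (Icc 0 P.l ×ˢ Icc (-P.τ) P.T) := by
        have g1 : ContinuousOn (fun p : ℝ × ℝ => μ₁ p.2) (Icc 0 P.l ×ˢ Icc (-P.τ) P.T) :=
          hμ₁.comp continuousOn_snd fun p hp => hp.2
        have g2 : ContinuousOn (fun p : ℝ × ℝ => μ₂ p.2) (Icc 0 P.l ×ˢ Icc (-P.τ) P.T) :=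
          hμ₂.comp continuousOn_snd fun p hp => hp.2
        exact g1.add (ContinuousOn.mul (by fun_prop) (g2.sub g1))
      exact h1.add (continuousOn_sineSeries _ (fun n _ => (hcont n).continuousOn)
        fun n hn t ht => hC2 n hn t ht.2)
    · have h1 : ContinuousOn (Function.uncurry (lift P (derivWithin μ₁ (Icc 0 P.T))
          (derivWithin μ₂ (Icc 0 P.T)))) (Icc 0 P.l ×ˢ Icc 0 P.T) := by
        have d1 := hμ₁'.continuousOn_derivWithin (uniqueDiffOn_Icc hT) le_rfl
        have d2 := hμ₂'.continuousOn_derivWithin (uniqueDiffOn_Icc hT) le_rfl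
        have g1 : ContinuousOn (fun p : ℝ × ℝ => derivWithin μ₁ (Icc 0 P.T) p.2)
            (Icc 0 P.l ×ˢ Icc 0 P.T) := d1.comp continuousOn_snd fun p hp => hp.2
        have g2 : ContinuousOn (fun p : ℝ × ℝ => derivWithin μ₂ (Icc 0 P.T) p.2)
            (Icc 0 P.l ×ˢ Icc 0 P.T) := d2.comp continuousOn_snd fun p hp => hp.2
        exact g1.add (ContinuousOn.mul (by fun_prop) (g2.sub g1))
      exact h1.add (continuousOn_sineSeries _ (fun n _ => (continuous_modeDeriv hcont n).continuousOn)
        hC')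
    · exact continuousOn_sineSeries _ (fun n _ => ((hcont n).const_mul _).continuousOn)
        fun n hn t ht => hκb n hn t ht.2
    · intro x _ t ht
      have d1 := ((hμ₁'.differentiableOn one_ne_zero) t ht).hasDerivWithinAt
      have d2 := ((hμ₂'.differentiableOn one_ne_zero) t ht).hasDerivWithinAt
      exact (d1.add ((d2.sub d1).const_mul (x / P.l))).add
        (hasDerivWithinAt_sineSeries hT.le
          (fun n _ s hs => hasDerivWithinAt_modeCoeff hl hτ hΦc n hs)
          (fun n _ => (continuous_modeDeriv hcont n).continuousOn)
          (fun n hn => hC2 n hn 0 hT.le) hC' x ht)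
    · intro x _ t ht
      constructor
      · have d1 : HasDerivAt (fun y => lift P μ₁ μ₂ y t) (1 / P.l * (μ₂ t - μ₁ t)) x :=
          (((hasDerivAt_id x).div_const P.l).mul_const _).const_add _
        exact (d1.add (hasDerivAt_sineSeries hl hC0 (fun n hn => hC n hn t ht.2) x)).hasDerivWithinAt
      · exact ((hasDerivAt_cosSeries hl hC0 (fun n hn => hC n hn t ht.2) x).const_add
          _).hasDerivWithinAt
    · intro x _ t ht
      have htd : t - P.τ ≤ P.T := by linarith [ht.2]
      have e1 := (summable_sineSeries (l := P.l) (fun n hn => hκb n hn t ht.2) x).hasSum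
      have e2 := (summable_sineSeries (l := P.l) (fun n hn => hκb n hn _ htd) x).hasSum
      have e3 := (summable_sineSeries (l := P.l) (fun n hn => hC2 n hn t ht.2) x).hasSum
      have e4 := (summable_sineSeries (l := P.l) (fun n hn => hC2 n hn _ htd) x).hasSum
      have e5 := (summable_sineSeries (l := P.l) (fun n hn => hF n hn t ht) x).hasSum
      have hsum := ((((e1.mul_left (P.a₁ ^ 2)).add (e2.mul_left (P.a₂ ^ 2))).add
        (e3.mul_left P.c₁)).add (e4.mul_left P.c₂)).add e5
      have hd : sineSeries P.l (modeDeriv P φ μ₁ μ₂ Ψ) x t =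
          P.a₁ ^ 2 * sineSeries P.l κ x t + P.a₂ ^ 2 * sineSeries P.l κ x (t - P.τ)
          + P.c₁ * sineSeries P.l (modeCoeff P φ μ₁ μ₂ Ψ) x t
          + P.c₂ * sineSeries P.l (modeCoeff P φ μ₁ μ₂ Ψ) x (t - P.τ)
          + control P φ μ₁ μ₂ Ψ x t := by
        refine HasSum.tsum_eq (hsum.congr_fun ?_)
        intro n
        simp only [modeDeriv, hκ, Params.L, Params.B]
        ring
      have h1 := (hdef t ht).1
      have h2 := (hdef t ht).2
      rw [boundaryDefect] at h1 h2
      simp only [hd, lift]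
      -- The affine part has no second space derivative and fails the equation only by the
      -- combination of the two defects with weights `1 - x/l` and `x/l`, which is zero.
      linear_combination (-(1 - x / P.l)) * h1 - x / P.l * h2
    · intro x hx t ht
      have h1 : ∀ n, sineCoeff P.l n (fun ξ => Phi P φ μ₁ μ₂ ξ t) =
          modeCoeff P φ μ₁ μ₂ Ψ n t := fun n => (modeCoeff_of_mem ht n).symm
      -- Compatibility makes `Φ(·, t)` vanish at both ends, so its sine series returns it.
      have hs := hasSum_sine_series hl (continuousOn_Phi_slice hΦc ht)
        (by rw [Phi, (hφ t ht).1, (lift_at_ends hl t).1, sub_self])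
        (by rw [Phi, (hφ t ht).2, (lift_at_ends hl t).2, sub_self])
        ((summable_div_sq C).of_norm_bounded fun n => by
          rw [h1]; exact hC2 (n + 1) (by omega) t (ht.2.trans hT.le)) hx
      simp only [h1] at hs
      have := hs.tsum_eq
      simp only [sineSeries, this, Phi]
      ring
    · intro t _
      simp only [(sineSeries_at_ends hl _ t).1, (sineSeries_at_ends hl _ t).2, add_zero]
      exact lift_at_ends hl t
  refine ⟨fun x _ t ht => summable_sineSeries (fun n hn => hF n hn t ht) x,
    continuousOn_sineSeries _ (fun n _ => (continuous_UCoeff P φ μ₁ μ₂ Ψ n).continuousOn) hF,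
    _, hu, fun v hv => hu.unique hl hτ hv, fun x hx => ?_⟩
  have hlift := (continuous_lift P μ₁ μ₂ P.T).continuousOn (s := Icc 0 P.l)
  have h1 : ∀ n : ℕ, sineCoeff P.l (n + 1) (fun ξ => Ψ ξ - lift P μ₁ μ₂ ξ P.T) =
      modeCoeff P φ μ₁ μ₂ Ψ (n + 1) P.T := fun n => by
    rw [modeCoeff_final hl hτ hT hμ₁ hμ₂ hΦc hdef (by omega) (hden _ (by omega)),
      sineCoeff_sub hl.le hΨ hlift, mCoeff]
  -- Summability of the target's coefficients comes from the bound on the modes at time `T`, with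
  -- which they coincide.
  have hs := hasSum_sine_series hl (hΨ.sub hlift)
    (by rw [Pi.sub_apply, hΨ₀, (lift_at_ends hl _).1, sub_self])
    (by rw [Pi.sub_apply, hΨl, (lift_at_ends hl _).2, sub_self])
    ((summable_div_sq C).of_norm_bounded fun n => by
      exact (congrArg _ (h1 n)).le.trans (hC2 (n + 1) (by omega) _ le_rfl)) hx
  have h2 := hs.tsum_eq
  have h3 : sineSeries P.l (modeCoeff P φ μ₁ μ₂ Ψ) x P.T = Ψ x - lift P μ₁ μ₂ x P.T := by
    rw [sineSeries]
    simp only [← h1]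
    exact h2
  simp only [h3]
  ring
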